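/- Let $k$ be a field and let $0\to\mathfrak n\to\mathfrak g\xrightarrow{\pi}\mathfrak h\to 0$ be a split extension of Lie algebras over $k$ (so $\pi$ has a section $\mathfrak h\to\mathfrak g$ that is a homomorphism of Lie algebras) with $\dim_k\mathfrak n=m<\infty$; $\mathfrak g$ and $\mathfrak h$ may be infinite-dimensional. Let $M$ be a $\mathfrak g$-module on which $\mathfrak n$ acts trivially, so that $M$ is also an $\mathfrak h$-module. Write $H^*$ for Lie algebra cohomology, computed by the Chevalley–Eilenberg complex $C^n(\mathfrak g,M)=\mathrm{Hom}_k(\Lambda^n\mathfrak g,M)$, and let $(E_r^{p,q},d_r^{p,q})$, $d_r^{p,q}:E_r^{p,q}\to E_r^{p+r,q-r+1}$, be the Hochschild–Serre spectral sequence $$E_2^{p,q}=H^p(\mathfrak h,H^q(\mathfrak n,M))\Rightarrow H^{p+q}(\mathfrak g,M),$$ that is, the spectral sequence of the filtration of $C^*(\mathfrak g,M)$ in which $F^pC^n(\mathfrak g,M)$ consists of the cochains that vanish whenever at least $n-p+1$ of their arguments lie in $\mathfrak n$. Its length $l$ is the smallest $t\ge 2$ with $E_t=E_\infty$, i.e.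 with $d_r=0$ for all $r\ge t$. Then: (a) $d_r^{p,m}=0$ for all $p\ge 0$ and all $r\ge 2$; (b) $l\le\max\{2,m\}$ (in particular $l$ is finite); (c) if $m\ge 1$, then for every $p\ge 0$ there is an injective $k$-linear map $$H^p(\mathfrak h,H^m(\mathfrak n,M))\oplus H^{p+m}(\mathfrak h,M)\hookrightarrow H^{p+m}(\mathfrak g,M).$$ -/

import Mathlib

attribute [local instance 100] LieRing.ofAssociativeRing

namespace LieCohomology

section Cochains

variable {k L V : Type*} [Field k] [LieRing L] [LieAlgebra k L] [AddCommGroup V] [Module k V]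

/-- The space `C^n(L, V) = Hom_k(Λ^n L, V)` of alternating `n`-cochains. -/
abbrev Cochain (k L V : Type*) [Field k] [LieRing L] [LieAlgebra k L] [AddCommGroup V]
    [Module k V] (n : ℕ) : Type _ :=
  L [⋀^Fin n]→ₗ[k] V

/-- Interior product `(ι_x ω)(x_1, …, x_n) = ω(x, x_1, …, x_n)`. -/
abbrev contract {n : ℕ} (x : L) (ω : Cochain k L V (n + 1)) : Cochain k L V n :=
  AlternatingMap.curryLeft ω x

theorem lieDer_sum_update (A : Module.End k L) {n : ℕ} (ω : Cochain k L V n) (v : Fin n → L)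
    (i : Fin n) (z : L) :
    ∑ j, ω (Function.update (Function.update v i z) j (A (Function.update v i z j))) =
      (ω (Function.update v i (A z)) +
        ∑ j, if j = i then 0 else ω (Function.update (Function.update v j (A (v j))) i z)) := by
  rw [← Finset.add_sum_erase _ _ (Finset.mem_univ i),
    ← Finset.add_sum_erase (a := i) _ (fun j => if j = i then (0 : V) else _) (Finset.mem_univ i)]
  simp only [Function.update_self, Function.update_idem, if_true, zero_add]
  congr 1
  refine Finset.sum_congr rfl fun j hj => ?_
  have h := Finset.ne_of_mem_erase hj
  rw [if_neg h, Function.update_of_ne h, Function.update_comm h]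

/-- The operator on cochains induced by an endomorphism `A` of `L` and an endomorphism `T` of `V`:
`(lieDer A T ω)(x_1, …, x_n) = T (ω(x_1, …, x_n)) - ∑ i, ω(x_1, …, A x_i, …, x_n)`. -/
def lieDer (A : Module.End k L) (T : Module.End k V) (n : ℕ) :
    Cochain k L V n →ₗ[k] Cochain k L V n where
  toFun ω :=
    { toFun := fun v => T (ω v) - ∑ i, ω (Function.update v i (A (v i)))
      map_update_add' := by
        intro inst v i x y
        obtain rfl : inst = instDecidableEqFin n := Subsingleton.elim _ _
        have h : ∀ (p : Prop) [Decidable p] (a b : V),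
            (if p then 0 else a + b) = (if p then 0 else a) + (if p then 0 else b) := by
          intro p _ a b; split_ifs <;> simp
        simp only [lieDer_sum_update, AlternatingMap.map_update_add, map_add, h,
          Finset.sum_add_distrib]
        abel
      map_update_smul' := by
        intro inst v i c x
        obtain rfl : inst = instDecidableEqFin n := Subsingleton.elim _ _
        simp only [lieDer_sum_update, AlternatingMap.map_update_smul, map_smul, smul_sub, smul_add,
          Finset.smul_sum, smul_ite, smul_zero]
      map_eq_zero_of_eq' := by
        intro v i j hv hij
        rw [ω.map_eq_zero_of_eq v hv hij, map_zero, zero_sub, neg_eq_zero,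
          Finset.sum_eq_add i j hij]
        · have : Function.update v j (A (v j)) =
              Function.update v i (A (v i)) ∘ Equiv.swap i j := by
            ext l
            rcases eq_or_ne l i with rfl | hi
            · simp [Function.update_of_ne hij, hij.symm, hv]
            · rcases eq_or_ne l j with rfl | hj
              · simp [hv]
              · simp [Equiv.swap_apply_of_ne_of_ne hi hj, hi, hj]
          rw [this, AlternatingMap.map_swap _ _ hij]
          simp
        · intro l _ hl
          exact ω.map_eq_zero_of_eq _ (by simp [hl.1.symm, hl.2.symm, hv]) hij
        · simp
        · simp }
  map_add' ω η := by
    ext v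
    simp [Finset.sum_add_distrib]
    abel
  map_smul' c ω := by
    ext v
    simp [Finset.smul_sum, smul_sub]

theorem lieDer_apply (A : Module.End k L) (T : Module.End k V) {n : ℕ} (ω : Cochain k L V n)
    (v : Fin n → L) :
    lieDer A T n ω v = T (ω v) - ∑ i, ω (Function.update v i (A (v i))) := rfl

theorem contract_lieDer (A : Module.End k L) (T : Module.End k V) {n : ℕ}
    (ω : Cochain k L V (n + 1)) (x : L) :
    contract x (lieDer A T (n + 1) ω) = lieDer A T n (contract x ω) - contract (A x) ω := by
  ext v
  simp only [AlternatingMap.curryLeft_apply_apply, lieDer_apply, AlternatingMap.sub_apply,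
    Fin.sum_univ_succ, Matrix.vecCons]
  simp only [Fin.cons_zero, Fin.cons_succ, Fin.update_cons_zero, ← Fin.cons_update]
  abel

theorem contract_ext {n : ℕ} {ω η : Cochain k L V (n + 1)}
    (h : ∀ x, contract x ω = contract x η) : ω = η := by
  ext v
  have := congrArg (fun f => f (Fin.tail v)) (h (v 0))
  simpa [Matrix.vecCons] using this

theorem lieDer_lie (A A' : Module.End k L) (T T' : Module.End k V) (n : ℕ)
    (ω : Cochain k L V n) :
    lieDer ⁅A, A'⁆ ⁅T, T'⁆ n ω =
      lieDer A T n (lieDer A' T' n ω) - lieDer A' T' n (lieDer A T n ω) := by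
  induction n with
  | zero =>
    ext v
    simp [lieDer_apply, LieRing.of_associative_ring_bracket]
  | succ n ih =>
    apply contract_ext
    intro x
    have e : ∀ a b : Cochain k L V (n + 1), contract x (a - b) = contract x a - contract x b :=
      fun a b => rfl
    have e' : ∀ (y z : L), contract (y - z) ω = contract y ω - contract z ω := fun y z => by
      simp [contract]
    have e2 : ⁅A, A'⁆ x = A (A' x) - A' (A x) := rfl
    simp only [e, contract_lieDer, ih, e2, e', map_sub]
    abel

/-- The value of the Chevalley–Eilenberg differential of an `n`-cochain on `(x_0, …, x_n)`, for
the representation `ρ` of `L` on `V`: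
`∑_j (-1)^j ρ(x_j) ω(…, x̂_j, …) + ∑_{i<j} (-1)^j ω(…, [x_i, x_j], …, x̂_j, …)`,
where `[x_i, x_j]` stands in the place of `x_i`. -/
def dFun (ρ : L →ₗ⁅k⁆ Module.End k V) {n : ℕ} (ω : Cochain k L V n) (v : Fin (n + 1) → L) : V :=
  ∑ j : Fin (n + 1), (-1 : ℤ) ^ (j : ℕ) •
    (ρ (v j) (ω (j.removeNth v)) +
      ∑ i : Fin n, if i.castSucc < j then
        ω (Function.update (j.removeNth v) i ⁅v i.castSucc, v j⁆) else 0)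

theorem dFun_zero_deg (ρ : L →ₗ⁅k⁆ Module.End k V) (ω : Cochain k L V 0) (v : Fin 1 → L) :
    dFun ρ ω v = ρ (v 0) (ω 0) := by
  simp [dFun, Subsingleton.elim (Fin.removeNth 0 v) 0]

theorem dFun_cons (ρ : L →ₗ⁅k⁆ Module.End k V) {n : ℕ} (ω : Cochain k L V (n + 1)) (x : L)
    (v : Fin (n + 1) → L) :
    dFun ρ ω (Fin.cons x v : Fin (n + 2) → L) =
      lieDer (LieAlgebra.ad k L x) (ρ x) (n + 1) ω v - dFun ρ (contract x ω) v := by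
  have hrem : ∀ j : Fin (n + 1), (Fin.removeNth j.succ (Fin.cons x v : Fin (n + 2) → L)) =
      Fin.cons x (j.removeNth v) := by
    intro j
    ext l
    refine Fin.cases ?_ (fun l => ?_) l <;> simp [Fin.removeNth]
  have h1 : ∀ j : Fin (n + 1), (-1 : ℤ) ^ (j : ℕ) •
      ω (Fin.cons ⁅x, v j⁆ (j.removeNth v)) = ω (Function.update v j ⁅x, v j⁆) := by
    intro j
    have h2 := AlternatingMap.map_insertNth ω j ⁅x, v j⁆ (j.removeNth v)
    rw [Fin.insertNth_removeNth] at h2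
    exact h2.symm
  rw [dFun, Fin.sum_univ_succ]
  simp only [hrem, Fin.cons_zero, Fin.cons_succ, Fin.val_succ, pow_succ, mul_neg, mul_one,
    neg_smul, Fin.not_lt_zero, if_false, Finset.sum_const_zero, add_zero, Fin.val_zero, pow_zero,
    one_smul, Finset.sum_neg_distrib]
  have h0 : Fin.removeNth 0 (Fin.cons x v : Fin (n + 2) → L) = v := by
    ext l; simp [Fin.removeNth]
  rw [h0, lieDer_apply, sub_sub, sub_eq_add_neg]
  congr 2
  rw [dFun, ← Finset.sum_add_distrib]
  refine Finset.sum_congr rfl fun j _ => ?_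
  rw [LieAlgebra.ad_apply, ← h1, ← smul_add]
  congr 1
  rw [Fin.sum_univ_succ]
  simp only [Fin.castSucc_zero, Fin.succ_pos, if_true, Fin.cons_zero, Fin.update_cons_zero,
    ← Fin.succ_castSucc, Fin.cons_succ, Fin.succ_lt_succ_iff, ← Fin.cons_update,
    AlternatingMap.curryLeft_apply_apply, Matrix.vecCons]
  abel

theorem dFun_add (ρ : L →ₗ⁅k⁆ Module.End k V) {n : ℕ} (ω η : Cochain k L V n)
    (v : Fin (n + 1) → L) : dFun ρ (ω + η) v = dFun ρ ω v + dFun ρ η v := by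
  simp only [dFun, ← Finset.sum_add_distrib, ← smul_add, AlternatingMap.add_apply, map_add]
  refine Finset.sum_congr rfl fun j _ => ?_
  congr 1
  rw [add_add_add_comm, ← Finset.sum_add_distrib]
  congr 1
  refine Finset.sum_congr rfl fun i _ => ?_
  split_ifs <;> simp

theorem dFun_smul (ρ : L →ₗ⁅k⁆ Module.End k V) {n : ℕ} (c : k) (ω : Cochain k L V n)
    (v : Fin (n + 1) → L) : dFun ρ (c • ω) v = c • dFun ρ ω v := by
  simp only [dFun, Finset.smul_sum, AlternatingMap.smul_apply, map_smul, smul_add,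
    smul_comm c ((-1 : ℤ) ^ _), smul_ite, smul_zero]

theorem exists_dFun (ρ : L →ₗ⁅k⁆ Module.End k V) (n : ℕ) (ω : Cochain k L V n) :
    ∃ η : Cochain k L V (n + 1), ∀ v, η v = dFun ρ ω v := by
  induction n with
  | zero =>
    refine ⟨{ toFun := dFun ρ ω, map_update_add' := ?_, map_update_smul' := ?_,
              map_eq_zero_of_eq' := ?_ }, fun v => rfl⟩
    · intro _ v i x y
      simp [dFun_zero_deg, Fin.fin_one_eq_zero i]
    · intro _ v i c x
      simp [dFun_zero_deg, Fin.fin_one_eq_zero i]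
    · intro v i j _ hij
      exact absurd ((Fin.fin_one_eq_zero i).trans (Fin.fin_one_eq_zero j).symm) hij
  | succ n ih =>
    choose D hD using ih
    have hcons : ∀ x v, dFun ρ ω (Fin.cons x v : Fin (n + 2) → L) =
        (lieDer (LieAlgebra.ad k L x) (ρ x) (n + 1) ω - D (contract x ω)) v := by
      intro x v
      rw [dFun_cons, AlternatingMap.sub_apply, hD]
    have hdiag : ∀ x (u : Fin n → L),
        (lieDer (LieAlgebra.ad k L x) (ρ x) (n + 1) ω - D (contract x ω))
          (Fin.cons x u : Fin (n + 1) → L) = 0 := by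
      intro x u
      have e1 : lieDer (LieAlgebra.ad k L x) (ρ x) (n + 1) ω (Fin.cons x u : Fin (n + 1) → L) =
          lieDer (LieAlgebra.ad k L x) (ρ x) n (contract x ω) u := by
        have := congrArg (fun f => f u)
          (contract_lieDer (LieAlgebra.ad k L x) (ρ x) ω x)
        simpa [Matrix.vecCons, contract] using this
      rw [AlternatingMap.sub_apply, hD, e1, sub_eq_zero]
      cases n with
      | zero =>
        rw [dFun_zero_deg, lieDer_apply]
        simp [Subsingleton.elim u 0]
      | succ n =>
        rw [dFun_cons]
        have : contract x (contract x ω) = 0 := AlternatingMap.curryLeft_same ω x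
        have e2 : dFun ρ (0 : Cochain k L V n) u = 0 := by
          simpa using dFun_smul ρ (0 : k) (0 : Cochain k L V n) u
        rw [this, e2, sub_zero]
    refine ⟨{ toFun := dFun ρ ω, map_update_add' := ?_, map_update_smul' := ?_,
              map_eq_zero_of_eq' := ?_ }, fun v => rfl⟩
    · intro inst v i x y
      rw [Subsingleton.elim inst (instDecidableEqFin _)]
      rw [← Fin.cons_self_tail v]
      refine Fin.cases ?_ (fun i => ?_) i
      · simp only [Fin.update_cons_zero]
        simp only [dFun_cons, lieDer_apply, map_add, LinearMap.add_apply,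
          AlternatingMap.map_update_add, Finset.sum_add_distrib, contract, dFun_add]
        abel
      · simp only [← Fin.cons_update, hcons, AlternatingMap.map_update_add]
    · intro inst v i c x
      rw [Subsingleton.elim inst (instDecidableEqFin _)]
      rw [← Fin.cons_self_tail v]
      refine Fin.cases ?_ (fun i => ?_) i
      · simp only [Fin.update_cons_zero]
        simp only [dFun_cons, lieDer_apply, map_smul, LinearMap.smul_apply,
          AlternatingMap.map_update_smul, contract, dFun_smul, smul_sub, Finset.smul_sum]
      · simp only [← Fin.cons_update, hcons, AlternatingMap.map_update_smul]
    · have key : ∀ (x : L) (w : Fin (n + 1) → L) (j : Fin (n + 1)), w j = x →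
          dFun ρ ω (Fin.cons x w : Fin (n + 2) → L) = 0 := by
        intro x w j hj
        rw [hcons]
        rcases eq_or_ne j 0 with rfl | h0
        · rw [← Fin.cons_self_tail w, hj, hdiag]
        · have h2 := AlternatingMap.map_swap
            (lieDer (LieAlgebra.ad k L x) (ρ x) (n + 1) ω - D (contract x ω)) w h0.symm
          rw [← Fin.cons_self_tail (w ∘ Equiv.swap 0 j)] at h2
          simp only [Function.comp_apply, Equiv.swap_apply_left, hj] at h2
          rw [hdiag] at h2
          exact neg_eq_zero.mp h2.symm
      intro v i j hv hij
      rw [← Fin.cons_self_tail v]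
      induction i using Fin.cases with
      | zero =>
        induction j using Fin.cases with
        | zero => exact absurd rfl hij
        | succ j => exact key _ _ j hv.symm
      | succ i =>
        induction j using Fin.cases with
        | zero => exact key _ _ i hv
        | succ j =>
          rw [hcons]
          exact AlternatingMap.map_eq_zero_of_eq _ _ hv (fun h => hij (congrArg _ h))

/-- The Chevalley–Eilenberg differential `C^n(L, V) → C^{n+1}(L, V)` of the representation `ρ`. -/
def d (ρ : L →ₗ⁅k⁆ Module.End k V) (n : ℕ) : Cochain k L V n →ₗ[k] Cochain k L V (n + 1) where
  toFun ω :=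
    { toFun := dFun ρ ω
      map_update_add' := by
        obtain ⟨η, hη⟩ := exists_dFun ρ n ω
        intro _ v i x y
        simp only [← hη, η.map_update_add]
      map_update_smul' := by
        obtain ⟨η, hη⟩ := exists_dFun ρ n ω
        intro _ v i c x
        simp only [← hη, η.map_update_smul]
      map_eq_zero_of_eq' := by
        obtain ⟨η, hη⟩ := exists_dFun ρ n ω
        intro v i j hv hij
        rw [← hη, η.map_eq_zero_of_eq v hv hij] }
  map_add' ω η := by ext v; exact dFun_add ρ ω η v
  map_smul' c ω := by ext v; exact dFun_smul ρ c ω v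

theorem contract_d (ρ : L →ₗ⁅k⁆ Module.End k V) {n : ℕ} (ω : Cochain k L V (n + 1)) (x : L) :
    contract x (d ρ (n + 1) ω) =
      lieDer (LieAlgebra.ad k L x) (ρ x) (n + 1) ω - d ρ n (contract x ω) := by
  ext v
  exact dFun_cons ρ ω x v

theorem contract_d_zero (ρ : L →ₗ⁅k⁆ Module.End k V) (ω : Cochain k L V 0) (x : L) :
    contract x (d ρ 0 ω) = lieDer (LieAlgebra.ad k L x) (ρ x) 0 ω := by
  ext v
  refine (dFun_zero_deg ρ ω _).trans ?_
  obtain rfl : v = 0 := Subsingleton.elim _ _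
  rw [lieDer_apply, Finset.univ_eq_empty, Finset.sum_empty, sub_zero]
  rfl

/-- A derivation `A` of `L` together with an endomorphism `T` of `V` such that
`[T, ρ(x)] = ρ(A x)` acts on cochains by operators commuting with the differential. -/
theorem lieDer_d (ρ : L →ₗ⁅k⁆ Module.End k V) (A : Module.End k L) (T : Module.End k V)
    (hA : ∀ x, ⁅A, LieAlgebra.ad k L x⁆ = LieAlgebra.ad k L (A x))
    (hT : ∀ x, ⁅T, ρ x⁆ = ρ (A x)) (n : ℕ) (ω : Cochain k L V n) :
    lieDer A T (n + 1) (d ρ n ω) = d ρ n (lieDer A T n ω) := by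
  have h3 : ∀ (n : ℕ) (x : L) (ω : Cochain k L V n),
      lieDer (LieAlgebra.ad k L (A x)) (ρ (A x)) n ω =
      lieDer A T n (lieDer (LieAlgebra.ad k L x) (ρ x) n ω) -
        lieDer (LieAlgebra.ad k L x) (ρ x) n (lieDer A T n ω) := by
    intro n x ω
    rw [← lieDer_lie, hA, hT]
  induction n with
  | zero =>
    apply contract_ext
    intro x
    rw [contract_lieDer, contract_d_zero, contract_d_zero, contract_d_zero, h3]
    abel
  | succ n ih =>
    apply contract_ext
    intro x
    rw [contract_lieDer, contract_d, contract_d, contract_d, contract_lieDer, h3, map_sub,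
      map_sub, ih]
    abel

theorem d_d (ρ : L →ₗ⁅k⁆ Module.End k V) (n : ℕ) (ω : Cochain k L V n) :
    d ρ (n + 1) (d ρ n ω) = 0 := by
  have hc : ∀ (n : ℕ) (x : L) (ω : Cochain k L V n),
      lieDer (LieAlgebra.ad k L x) (ρ x) (n + 1) (d ρ n ω) =
        d ρ n (lieDer (LieAlgebra.ad k L x) (ρ x) n ω) := by
    intro n x ω
    refine lieDer_d ρ _ _ (fun y => ?_) (fun y => ?_) n ω
    · rw [LieAlgebra.ad_apply, LieHom.map_lie]
    · rw [LieAlgebra.ad_apply, LieHom.map_lie]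
  induction n with
  | zero =>
    apply contract_ext
    intro x
    rw [contract_d, hc, contract_d_zero, sub_self]
    rfl
  | succ n ih =>
    apply contract_ext
    intro x
    rw [contract_d, hc, contract_d, map_sub, ih, sub_zero, sub_self]
    rfl

end Cochains

section Cohomology

variable {k L V : Type*} [Field k] [LieRing L] [LieAlgebra k L] [AddCommGroup V] [Module k V]

/-- The coboundaries `B^n(L, V) ⊆ C^n(L, V)`. -/
def coboundaries (ρ : L →ₗ⁅k⁆ Module.End k V) : ∀ n : ℕ, Submodule k (Cochain k L V n)
  | 0 => ⊥
  | n + 1 => LinearMap.range (d ρ n)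

/-- The cocycles `Z^n(L, V) ⊆ C^n(L, V)`. -/
def cocycles (ρ : L →ₗ⁅k⁆ Module.End k V) (n : ℕ) : Submodule k (Cochain k L V n) :=
  LinearMap.ker (d ρ n)

/-- The Lie algebra cohomology `H^n(L, V)` with coefficients in the `L`-module given by the
representation `ρ` of `L` on `V`. -/
abbrev Cohomology (ρ : L →ₗ⁅k⁆ Module.End k V) (n : ℕ) : Type _ :=
  cocycles ρ n ⧸ (coboundaries ρ n).submoduleOf (cocycles ρ n)

theorem lieDer_add (A A' : Module.End k L) (T T' : Module.End k V) {n : ℕ}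
    (ω : Cochain k L V n) :
    lieDer (A + A') (T + T') n ω = lieDer A T n ω + lieDer A' T' n ω := by
  ext v
  simp only [lieDer_apply, AlternatingMap.add_apply, LinearMap.add_apply,
    AlternatingMap.map_update_add, Finset.sum_add_distrib]
  abel

theorem lieDer_smul (c : k) (A : Module.End k L) (T : Module.End k V) {n : ℕ}
    (ω : Cochain k L V n) :
    lieDer (c • A) (c • T) n ω = c • lieDer A T n ω := by
  ext v
  simp only [lieDer_apply, AlternatingMap.smul_apply, LinearMap.smul_apply,
    AlternatingMap.map_update_smul, Finset.smul_sum, smul_sub]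

/-- The endomorphism of `H^n(L, V)` induced by `lieDer A T`. -/
def cohomologyDer (ρ : L →ₗ⁅k⁆ Module.End k V) (A : Module.End k L) (T : Module.End k V)
    (hA : ∀ x, ⁅A, LieAlgebra.ad k L x⁆ = LieAlgebra.ad k L (A x))
    (hT : ∀ x, ⁅T, ρ x⁆ = ρ (A x)) (n : ℕ) : Module.End k (Cohomology ρ n) :=
  Submodule.mapQ _ _
    ((lieDer A T n).restrict (p := cocycles ρ n) (q := cocycles ρ n) (by
      intro ω hω
      have h : d ρ n ω = 0 := hω
      change d ρ n (lieDer A T n ω) = 0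
      rw [← lieDer_d ρ A T hA hT, h, map_zero]))
    (by
      rintro ⟨ω, hω⟩ h
      cases n with
      | zero =>
        have h0 : ω = 0 := h
        change lieDer A T 0 ω = 0
        rw [h0, map_zero]
      | succ n =>
        obtain ⟨η, hη⟩ : ∃ η, d ρ n η = ω := h
        change ∃ ζ, d ρ n ζ = lieDer A T (n + 1) ω
        exact ⟨lieDer A T n η, by rw [← lieDer_d ρ A T hA hT, hη]⟩)

/-- Let a Lie algebra `K` act on `L` by derivations, through `α`, and on `V`, through `τ`, such that
`[τ(x), ρ(y)] = ρ(α(x) y)`. This is the induced action of `K` on `H^n(L, V)`, given on cochains by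
`(x · ω)(y_1, …, y_n) = τ(x) (ω(y_1, …, y_n)) - ∑ i, ω(y_1, …, α(x) y_i, …, y_n)`. -/
def cohomologyRep {K : Type*} [LieRing K] [LieAlgebra k K] (ρ : L →ₗ⁅k⁆ Module.End k V)
    (α : K →ₗ⁅k⁆ Module.End k L) (τ : K →ₗ⁅k⁆ Module.End k V)
    (hα : ∀ x y, ⁅α x, LieAlgebra.ad k L y⁆ = LieAlgebra.ad k L (α x y))
    (hτ : ∀ x y, ⁅τ x, ρ y⁆ = ρ (α x y)) (n : ℕ) : K →ₗ⁅k⁆ Module.End k (Cohomology ρ n) where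
  toFun x := cohomologyDer ρ (α x) (τ x) (hα x) (hτ x) n
  map_add' x y := by
    refine Submodule.linearMap_qext _ (LinearMap.ext fun ω => ?_)
    refine congrArg (Submodule.Quotient.mk) (Subtype.ext ?_)
    change lieDer (α (x + y)) (τ (x + y)) n ω.1 = _
    rw [map_add, map_add, lieDer_add]
    rfl
  map_smul' c x := by
    refine Submodule.linearMap_qext _ (LinearMap.ext fun ω => ?_)
    refine congrArg (Submodule.Quotient.mk) (Subtype.ext ?_)
    change lieDer (α (c • x)) (τ (c • x)) n ω.1 = _
    rw [map_smul, map_smul, lieDer_smul]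
    rfl
  map_lie' {x y} := by
    refine Submodule.linearMap_qext _ (LinearMap.ext fun ω => ?_)
    refine congrArg (Submodule.Quotient.mk) (Subtype.ext ?_)
    change lieDer (α ⁅x, y⁆) (τ ⁅x, y⁆) n ω.1 = _
    rw [LieHom.map_lie, LieHom.map_lie, lieDer_lie]
    rfl

end Cohomology

section Extension

variable {k N G H M : Type*} [Field k] [LieRing N] [LieAlgebra k N] [LieRing G] [LieAlgebra k G]
  [LieRing H] [LieAlgebra k H]

theorem lie_mem_range (i : N →ₗ⁅k⁆ G) (π : G →ₗ⁅k⁆ H) [LieAlgebra.IsExtension i π] (x : G) (y : N) :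
    ⁅x, i y⁆ ∈ LinearMap.range (i : N →ₗ[k] G) := by
  have hex := (LieHom.range_eq_ker_iff i π).mp (LieAlgebra.IsExtension.exact (i := i) (p := π))
  refine (hex ⁅x, i y⁆).mp ?_
  rw [LieHom.map_lie, (hex (i y)).mpr ⟨y, rfl⟩, lie_zero]

theorem incl_injective (i : N →ₗ⁅k⁆ G) (π : G →ₗ⁅k⁆ H) [LieAlgebra.IsExtension i π] :
    Function.Injective (i : N →ₗ[k] G) :=
  (LieHom.ker_eq_bot i).mp (LieAlgebra.IsExtension.ker_eq_bot (p := π))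

/-- For an extension `0 → N → G → H → 0`, with `N` embedded in `G` by `i`, the endomorphism
`y ↦ i⁻¹ [x, i y]` of `N`. -/
noncomputable def kernelAd (i : N →ₗ⁅k⁆ G) (π : G →ₗ⁅k⁆ H) [LieAlgebra.IsExtension i π] (x : G) :
    Module.End k N :=
  (LinearEquiv.ofInjective (i : N →ₗ[k] G) (incl_injective i π)).symm.toLinearMap ∘ₗ
    LinearMap.codRestrict (LinearMap.range (i : N →ₗ[k] G))
      ((LieAlgebra.ad k G x) ∘ₗ (i : N →ₗ[k] G)) (fun y => lie_mem_range i π x y)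

theorem incl_kernelAd (i : N →ₗ⁅k⁆ G) (π : G →ₗ⁅k⁆ H) [LieAlgebra.IsExtension i π] (x : G) (y : N) :
    i (kernelAd i π x y) = ⁅x, i y⁆ :=
  LinearEquiv.ofInjective_symm_apply (i : N →ₗ[k] G) (h := incl_injective i π)
    (⟨⁅x, i y⁆, lie_mem_range i π x y⟩ : LinearMap.range (i : N →ₗ[k] G))

/-- The adjoint action of `G` on the kernel `N` of an extension `0 → N → G → H → 0`. -/
noncomputable def kernelRep (i : N →ₗ⁅k⁆ G) (π : G →ₗ⁅k⁆ H) [LieAlgebra.IsExtension i π] :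
    G →ₗ⁅k⁆ Module.End k N where
  toFun := kernelAd i π
  map_add' x x' := LinearMap.ext fun y => incl_injective i π <| by
    simp [incl_kernelAd]
  map_smul' c x := LinearMap.ext fun y => incl_injective i π <| by
    simp [incl_kernelAd]
  map_lie' {x x'} := LinearMap.ext fun y => incl_injective i π <| by
    have e : (⁅kernelAd i π x, kernelAd i π x'⁆ : Module.End k N) y =
      kernelAd i π x (kernelAd i π x' y) - kernelAd i π x' (kernelAd i π x y) := rfl
    simp [incl_kernelAd, e]

variable [AddCommGroup M] [Module k M]

/-- For an extension `0 → N → G → H → 0` and a representation `ρ` of `G` on `M`, the action of `G`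
on `H^q(N, M)`, given on cochains by
`(x · ω)(y_1, …, y_q) = x · ω(y_1, …, y_q) - ∑ i, ω(y_1, …, [x, y_i], …, y_q)`. -/
noncomputable def kernelCohomologyRep (i : N →ₗ⁅k⁆ G) (π : G →ₗ⁅k⁆ H) [LieAlgebra.IsExtension i π]
    (ρ : G →ₗ⁅k⁆ Module.End k M) (q : ℕ) :
    G →ₗ⁅k⁆ Module.End k (Cohomology (ρ.comp i) q) :=
  cohomologyRep (ρ.comp i) (kernelRep i π) ρ
    (fun x y => LinearMap.ext fun z => incl_injective i π <| by
      have e : (⁅kernelRep i π x, LieAlgebra.ad k N y⁆ : Module.End k N) z =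
        kernelAd i π x ⁅y, z⁆ - ⁅y, kernelAd i π x z⁆ := rfl
      have e' : kernelRep i π x y = kernelAd i π x y := rfl
      simp [e, e', incl_kernelAd])
    (fun x y => by
      have e' : kernelRep i π x y = kernelAd i π x y := rfl
      rw [LieHom.comp_apply, LieHom.comp_apply, e', incl_kernelAd, LieHom.map_lie]) q

end Extension

section HochschildSerre

variable {k G M : Type*} [Field k] [LieRing G] [LieAlgebra k G] [AddCommGroup M] [Module k M]

/-- The Hochschild–Serre filtration of the Chevalley–Eilenberg complex of `G` relative to the ideal
`I`: the submodule `F^p C^n(G, M)` consists of the cochains that vanish as soon as at least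
`n - p + 1` of their `n` arguments lie in `I`. It is all of `C^n` for `p ≤ 0` and `0` for
`p > n`. -/
def hsFiltration (M : Type*) [AddCommGroup M] [Module k M] (I : LieIdeal k G) (p : ℤ) (n : ℕ) :
    Submodule k (Cochain k G M n) where
  carrier := {ω | ∀ (v : Fin n → G) (S : Finset (Fin n)),
    (n : ℤ) - p + 1 ≤ S.card → (∀ j ∈ S, v j ∈ I) → ω v = 0}
  add_mem' {a b} ha hb v S hS hv := by simp [ha v S hS hv, hb v S hS hv]
  zero_mem' _ _ _ _ := rfl
  smul_mem' c a ha v S hS hv := by simp [ha v S hS hv]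

/-- `Z_r^{p,q} = F^p C^{p+q} ∩ d⁻¹(F^{p+r} C^{p+q+1})`, indexed by `r`, `p` and the total degree
`n = p + q`. -/
def hsZ (ρ : G →ₗ⁅k⁆ Module.End k M) (I : LieIdeal k G) (r p : ℤ) (n : ℕ) :
    Submodule k (Cochain k G M n) :=
  hsFiltration M I p n ⊓ (hsFiltration M I (p + r) (n + 1)).comap (d ρ n)

/-- `B_r^{p,q} = F^p C^{p+q} ∩ d(F^{p-r} C^{p+q-1})`, indexed by `r`, `p` and the total degree
`n = p + q`. -/
def hsB (ρ : G →ₗ⁅k⁆ Module.End k M) (I : LieIdeal k G) (r p : ℤ) :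
    ∀ n : ℕ, Submodule k (Cochain k G M n)
  | 0 => ⊥
  | n + 1 => hsFiltration M I p (n + 1) ⊓ (hsFiltration M I (p - r) n).map (d ρ n)

/-- The term `E_r^{p,q} = Z_r^{p,q} / (Z_{r-1}^{p+1,q-1} + B_{r-1}^{p,q})` of the Hochschild–Serre
spectral sequence of the ideal `I` of `G` with coefficients in `M`, indexed by `r`, `p` and the
total degree `n = p + q`. -/
abbrev hsPage (ρ : G →ₗ⁅k⁆ Module.End k M) (I : LieIdeal k G) (r : ℕ) (p : ℤ) (n : ℕ) : Type _ :=
  hsZ ρ I r p n ⧸ (hsZ ρ I (r - 1) (p + 1) n ⊔ hsB ρ I (r - 1) p n).submoduleOf (hsZ ρ I r p n)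

/-- The differential `d_r^{p,q} : E_r^{p,q} → E_r^{p+r,q-r+1}` of the Hochschild–Serre spectral
sequence, induced by the differential of the Chevalley–Eilenberg complex; `n = p + q`. -/
def hsDiff (ρ : G →ₗ⁅k⁆ Module.End k M) (I : LieIdeal k G) (r : ℕ) (p : ℤ) (n : ℕ) :
    hsPage ρ I r p n →ₗ[k] hsPage ρ I r (p + r) (n + 1) :=
  Submodule.mapQ _ _
    ((d ρ n).restrict (p := hsZ ρ I r p n) (q := hsZ ρ I r (p + r) (n + 1)) (by
      intro ω hω
      refine ⟨hω.2, ?_⟩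
      change d ρ (n + 1) (d ρ n ω) ∈ hsFiltration M I (p + r + r) (n + 1 + 1)
      rw [d_d]
      exact Submodule.zero_mem _))
    (by
      rintro ⟨ω, hω⟩ h
      obtain ⟨a, ha, b, hb, hab⟩ := Submodule.mem_sup.mp (show ω ∈ _ from h)
      have hdb : d ρ n b = 0 := by
        cases n with
        | zero => rw [show b = 0 from hb, map_zero]
        | succ n =>
          obtain ⟨c, -, rfl⟩ := hb.2
          exact d_d ρ n c
      have hda : d ρ n ω = d ρ n a := by rw [← hab, map_add, hdb, add_zero]
      change d ρ n ω ∈ hsZ ρ I (r - 1) (p + r + 1) (n + 1) ⊔ hsB ρ I (r - 1) (p + r) (n + 1)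
      refine Submodule.mem_sup_right ⟨hω.2, ⟨a, ?_, hda.symm⟩⟩
      have hp : p + (r : ℤ) - ((r : ℤ) - 1) = p + 1 := by ring
      rw [hp]
      exact ha.1)

/-- The length of the Hochschild–Serre spectral sequence `(E_r, d_r)_{r ≥ 2}`: the smallest `t ≥ 2`
with `E_t = E_∞`, that is, with `d_r = 0` for all `r ≥ t`; it is `⊤` if there is no such `t`. -/
noncomputable def hsLength (ρ : G →ₗ⁅k⁆ Module.End k M) (I : LieIdeal k G) : ℕ∞ :=
  ⨅ t ∈ {t : ℕ | 2 ≤ t ∧ ∀ r ≥ t, ∀ (p : ℤ) (n : ℕ), hsDiff ρ I r p n = 0}, (t : ℕ∞)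

end HochschildSerre

end LieCohomology

/-!
Identify `N` with its image in `G` and write `G = N ⊕ s(H)`. Cochains of `G` then have components
in `C^p(H, C^q(N, M))` (`mixed`), and since `s(H)` is a subalgebra the Chevalley–Eilenberg complex
of `G` is the total complex of the double complex `C^p(H, C^q(N, M))`. Only the rows `q = m` and
`q = 0` have to be understood.

*The top row `q = m = dim N`.* A cochain of degree `m + p` lies in `F^{p+1}` if and only if its
component in `C^p(H, C^m(N, M))` is zero (`mixed_eq_zero_iff`), because `m + 1` arguments from `N`
are linearly dependent. By Cartan's formula, `d ι_x + ι_x d = L_x` is multiplication by `-tr(ad x)`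
on `C^m(N, M)`, for `x` in `N`. There are two cases.

* If `tr(ad x) ≠ 0` for some `x`, then `H^m(N, M) = 0` (`subsingleton_cohomology_top`), and every
  cochain of degree `m + p` differs from one in `F^{p+1}` by a coboundary
  (`exists_mem_vanishing_d_eq`).
* If `N` is unimodular, then `d : C^{m-1}(N, M) → C^m(N, M)` is zero (`d_eq_zero_of_unimodular`).
  The exterior product with a volume form of `N`, extended by zero on `s(H)`, lifts
  `C^p(H, C^m(N, M))` to `C^{m+p}(G, M)` (`exists_mixed_eq`), compatibly with the differentials
  (`d_lift`). Subtracting the lift of its component moves a cochain into `F^{p+1}`, and the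
  differential of the lift of a cocycle is zero.

In both cases the differentials that start in the top row are zero (`hsDiff_top_row`).

*The bottom row `q = 0`.* It is the inflation of `C^*(H, M)`, and restriction along `s` is a left
inverse of inflation. Hence no differential hits this row (`hsDiff_bottom_row`). A nonzero `d_r`
from row `q` needs `r - 1 ≤ q ≤ m`; by the two vanishing statements neither end can be attained, so
that `r ≤ q ≤ m - 1`, and this bounds the length.

*The embedding.* Lifting from the top row and inflation from the bottom row are maps of complexes.
The lifts restrict to zero on `s(H)` when `m ≥ 1`, so restriction along `s` recovers the second
summand, and the component in the top row then recovers the first one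
(`exists_injective_of_coboundaries_eq_bot`). If `N` is not unimodular, the first summand is zero.
-/

namespace LieCohomology

/-! ### Cochains vanishing on arguments from a subspace -/

section Vanishing

variable {k L V : Type*} [Field k] [LieRing L] [LieAlgebra k L] [AddCommGroup V] [Module k V]

theorem apply_eq_contract {n : ℕ} (ω : Cochain k L V (n + 1)) (v : Fin (n + 1) → L)
    (j : Fin (n + 1)) : ω v = (-1) ^ (j : ℕ) • contract (v j) ω (j.removeNth v) := by
  have h := AlternatingMap.map_insertNth ω j (v j) (j.removeNth v)
  rwa [Fin.insertNth_removeNth, Function.update_eq_self] at h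

theorem card_filter_succAbove_mem {n : ℕ} (T : Finset (Fin (n + 1))) (j : Fin (n + 1)) :
    (Finset.univ.filter fun i : Fin n => j.succAbove i ∈ T).card = (T.erase j).card := by
  rw [← Finset.card_map (Fin.succAboveEmb j)]
  congr 1
  ext l
  simp only [Finset.mem_map, Finset.mem_filter, Finset.mem_univ, true_and, Fin.coe_succAboveEmb,
    Finset.mem_erase]
  constructor
  · rintro ⟨a, ha, rfl⟩
    exact ⟨Fin.succAbove_ne j a, ha⟩
  · rintro ⟨hl, hT⟩
    obtain ⟨a, rfl⟩ := Fin.exists_succAbove_eq hl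
    exact ⟨a, hT, rfl⟩

variable (V) in
/-- The `n`-cochains on `L` that vanish as soon as at least `b` of their arguments lie in the
subspace `S`. -/
def vanishing (S : Submodule k L) (b n : ℕ) : Submodule k (Cochain k L V n) where
  carrier := {ω | ∀ (v : Fin n → L) (T : Finset (Fin n)), b ≤ T.card → (∀ j ∈ T, v j ∈ S) → ω v = 0}
  add_mem' {a b} ha hb v T hT hv := by simp [ha v T hT hv, hb v T hT hv]
  zero_mem' _ _ _ _ := rfl
  smul_mem' c a ha v T hT hv := by simp [ha v T hT hv]

variable {S : Submodule k L} {b n : ℕ}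

theorem mem_vanishing_of_lt (h : n < b) (ω : Cochain k L V n) : ω ∈ vanishing V S b n := by
  intro v T hT _
  have := T.card_le_univ
  rw [Fintype.card_fin] at this
  omega

theorem eq_zero_of_mem_vanishing_zero {ω : Cochain k L V n} (h : ω ∈ vanishing V S 0 n) : ω = 0 :=
  AlternatingMap.ext fun v => h v ∅ (Nat.zero_le _) (by simp)

theorem mem_vanishing_of_finrank_lt [FiniteDimensional k S] (h : Module.finrank k S < b)
    (ω : Cochain k L V n) : ω ∈ vanishing V S b n := by
  intro v T hT hv
  refine AlternatingMap.map_linearDependent ω v fun hli => ?_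
  have h1 : LinearIndependent k (fun j : T => (⟨v j, hv j j.2⟩ : S)) := by
    refine LinearIndependent.of_comp S.subtype ?_
    exact hli.comp (fun j : T => (j : Fin n)) Subtype.val_injective
  have := h1.fintype_card_le_finrank
  rw [Fintype.card_coe] at this
  omega

/-- Membership in `vanishing` is inherited through interior products with elements of `S`, which
allows inductions based on Cartan's formula. -/
theorem mem_vanishing_succ_iff {ω : Cochain k L V (n + 1)} :
    ω ∈ vanishing V S (b + 1) (n + 1) ↔ ∀ x ∈ S, contract x ω ∈ vanishing V S b n := by
  constructor
  · intro h x hx v T hT hv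
    refine h (Matrix.vecCons x v) (insert 0 (T.map (Fin.succEmb n))) ?_ ?_
    · rw [Finset.card_insert_of_notMem (by simp), Finset.card_map]
      omega
    · intro j hj
      rcases Finset.mem_insert.mp hj with rfl | hj
      · simpa using hx
      · obtain ⟨a, ha, rfl⟩ := Finset.mem_map.mp hj
        simpa using hv a ha
  · intro h v T hT hv
    obtain ⟨j, hj⟩ : T.Nonempty := Finset.card_pos.mp (by omega)
    rw [apply_eq_contract ω v j, h (v j) (hv j hj) _
      (Finset.univ.filter fun i : Fin n => j.succAbove i ∈ T), smul_zero]
    · rw [card_filter_succAbove_mem, Finset.card_erase_of_mem hj]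
      omega
    · intro a ha
      exact hv _ (Finset.mem_filter.mp ha).2

theorem contract_mem_vanishing {ω : Cochain k L V (n + 1)} (h : ω ∈ vanishing V S b (n + 1))
    (x : L) : contract x ω ∈ vanishing V S b n := by
  intro v T hT hv
  refine h (Matrix.vecCons x v) (T.map (Fin.succEmb n)) (by rwa [Finset.card_map]) fun j hj => ?_
  obtain ⟨a, ha, rfl⟩ := Finset.mem_map.mp hj
  simpa using hv a ha

/-- The condition can be checked on the interior products with all vectors, not only with those
of `S`, as long as there is room for an argument outside the `b` chosen ones. -/
theorem mem_vanishing_of_contract (hb : b ≤ n) {ω : Cochain k L V (n + 1)}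
    (h : ∀ x, contract x ω ∈ vanishing V S b n) : ω ∈ vanishing V S b (n + 1) := by
  intro v T hT hv
  obtain ⟨j, hj⟩ : ∃ j, b ≤ (T.erase j).card := by
    by_cases hu : T = Finset.univ
    · exact ⟨0, by simpa [hu, Finset.card_erase_of_mem] using hb⟩
    · obtain ⟨j, hj⟩ : ∃ j, j ∉ T := by
        by_contra! hc
        exact hu (Finset.eq_univ_iff_forall.mpr hc)
      exact ⟨j, by rwa [Finset.erase_eq_of_notMem hj]⟩
  rw [apply_eq_contract ω v j, h (v j) _
      (Finset.univ.filter fun i : Fin n => j.succAbove i ∈ T), smul_zero]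
  · rwa [card_filter_succAbove_mem]
  · intro a ha
    exact hv _ (Finset.mem_filter.mp ha).2

theorem contract_add (x y : L) (ω : Cochain k L V (n + 1)) :
    contract (x + y) ω = contract x ω + contract y ω :=
  map_add (AlternatingMap.curryLeft ω) x y

/-- Split each of the `n` arguments along `L = S + S'`: a resulting tuple has at least `a` entries in
`S` or at least `b` entries in `S'`. -/
theorem eq_zero_of_mem_vanishing {S' : Submodule k L} (hS : S ⊔ S' = ⊤) {a b n : ℕ}
    (h : a + b ≤ n + 1) {ω : Cochain k L V n} (ha : ω ∈ vanishing V S a n)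
    (hb : ω ∈ vanishing V S' b n) : ω = 0 := by
  induction n generalizing a b with
  | zero =>
    obtain rfl | rfl : a = 0 ∨ b = 0 := by omega
    · exact eq_zero_of_mem_vanishing_zero ha
    · exact eq_zero_of_mem_vanishing_zero hb
  | succ n ih =>
    cases a with
    | zero => exact eq_zero_of_mem_vanishing_zero ha
    | succ a =>
      cases b with
      | zero => exact eq_zero_of_mem_vanishing_zero hb
      | succ b =>
        refine contract_ext fun x => ?_
        obtain ⟨y, hy, z, hz, rfl⟩ := Submodule.mem_sup.mp (hS ▸ Submodule.mem_top : x ∈ S ⊔ S')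
        rw [contract_add,
          ih (by omega) (mem_vanishing_succ_iff.mp ha y hy) (contract_mem_vanishing hb y),
          ih (by omega) (contract_mem_vanishing ha z) (mem_vanishing_succ_iff.mp hb z hz)]
        simp [contract]

theorem lieDer_mem_vanishing (A : Module.End k L) (T : Module.End k V) (hA : ∀ x ∈ S, A x ∈ S)
    {ω : Cochain k L V n} (h : ω ∈ vanishing V S b n) : lieDer A T n ω ∈ vanishing V S b n := by
  induction b generalizing n with
  | zero => rw [eq_zero_of_mem_vanishing_zero h, map_zero]; exact Submodule.zero_mem _
  | succ b ih =>
    cases n with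
    | zero => exact mem_vanishing_of_lt (Nat.succ_pos b) _
    | succ n =>
      refine mem_vanishing_succ_iff.mpr fun x hx => ?_
      rw [contract_lieDer]
      exact Submodule.sub_mem _ (ih (mem_vanishing_succ_iff.mp h x hx))
        (mem_vanishing_succ_iff.mp h _ (hA x hx))

/-- The differential turns cochains killed by any `b` arguments from a subalgebra into cochains
killed by any `b + 1` such arguments. -/
theorem d_mem_vanishing (ρ : L →ₗ⁅k⁆ Module.End k V) (hS : ∀ x ∈ S, ∀ y ∈ S, ⁅x, y⁆ ∈ S)
    {ω : Cochain k L V n} (h : ω ∈ vanishing V S b n) :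
    d ρ n ω ∈ vanishing V S (b + 1) (n + 1) := by
  induction b generalizing n with
  | zero => rw [eq_zero_of_mem_vanishing_zero h, map_zero]; exact Submodule.zero_mem _
  | succ b ih =>
    refine mem_vanishing_succ_iff.mpr fun x hx => ?_
    have hl : lieDer (LieAlgebra.ad k L x) (ρ x) n ω ∈ vanishing V S (b + 1) n :=
      lieDer_mem_vanishing _ _ (fun y hy => hS x hx y hy) h
    cases n with
    | zero => rwa [contract_d_zero]
    | succ n =>
      rw [contract_d]
      exact Submodule.sub_mem _ hl (ih (mem_vanishing_succ_iff.mp h x hx))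

end Vanishing

/-! ### Functoriality of the Chevalley–Eilenberg complex -/

section Functoriality

variable {k L L' V W : Type*} [Field k] [LieRing L] [LieAlgebra k L] [LieRing L'] [LieAlgebra k L']
  [AddCommGroup V] [Module k V] [AddCommGroup W] [Module k W]

theorem d_compLinearMap (ρ : L →ₗ⁅k⁆ Module.End k V) (f : L' →ₗ⁅k⁆ L) {n : ℕ}
    (ω : Cochain k L V n) :
    d (ρ.comp f) n (ω.compLinearMap (f : L' →ₗ[k] L)) =
      (d ρ n ω).compLinearMap (f : L' →ₗ[k] L) := by
  ext v
  change dFun _ _ v = dFun ρ ω (fun j => f (v j))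
  simp only [dFun, AlternatingMap.compLinearMap_apply]
  refine Finset.sum_congr rfl fun j _ => ?_
  congr 2
  refine Finset.sum_congr rfl fun i _ => ?_
  split_ifs
  · congr 1
    funext l
    rcases eq_or_ne l i with rfl | hl
    · simp
    · simp [hl, Fin.removeNth]
  · rfl

theorem lieDer_compLinearMap (f : L' →ₗ[k] L) (A : Module.End k L) (A' : Module.End k L')
    (hA : ∀ y, f (A' y) = A (f y)) (T : Module.End k V) {n : ℕ} (ω : Cochain k L V n) :
    (lieDer A T n ω).compLinearMap f = lieDer A' T n (ω.compLinearMap f) := by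
  ext v
  rw [lieDer_apply, AlternatingMap.compLinearMap_apply, lieDer_apply,
    AlternatingMap.compLinearMap_apply]
  refine congrArg₂ _ rfl (Finset.sum_congr rfl fun j _ => ?_)
  rw [AlternatingMap.compLinearMap_apply]
  refine congrArg ω (funext fun l => ?_)
  rcases eq_or_ne l j with rfl | hl
  · simp [hA]
  · simp [hl]

theorem d_compAlternatingMap (ρ : L →ₗ⁅k⁆ Module.End k V) (ρ' : L →ₗ⁅k⁆ Module.End k W)
    (g : V →ₗ[k] W) (hg : ∀ x v, g (ρ x v) = ρ' x (g v)) {n : ℕ} (ω : Cochain k L V n) :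
    d ρ' n (g.compAlternatingMap ω) = g.compAlternatingMap (d ρ n ω) := by
  ext v
  change dFun _ _ v = g (dFun ρ ω v)
  simp only [dFun, map_sum, map_zsmul, map_add, hg, LinearMap.compAlternatingMap_apply]
  refine Finset.sum_congr rfl fun j _ => ?_
  congr 2
  refine Finset.sum_congr rfl fun i _ => ?_
  split_ifs <;> simp

/-- Let a Lie algebra `K` act on `L` through `α` and on `V` through `τ`. This is the induced action
of `K` on the `n`-cochains of `L` with values in `V`. -/
def cochainRep {K : Type*} [LieRing K] [LieAlgebra k K] (α : K →ₗ⁅k⁆ Module.End k L)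
    (τ : K →ₗ⁅k⁆ Module.End k V) (n : ℕ) : K →ₗ⁅k⁆ Module.End k (Cochain k L V n) where
  toFun x := lieDer (α x) (τ x) n
  map_add' x y := LinearMap.ext fun ω => by
    rw [map_add, map_add, lieDer_add]; rfl
  map_smul' c x := LinearMap.ext fun ω => by
    rw [map_smul, map_smul, lieDer_smul]; rfl
  map_lie' {x y} := LinearMap.ext fun ω => by
    change lieDer (α ⁅x, y⁆) (τ ⁅x, y⁆) n ω = _
    rw [LieHom.map_lie, LieHom.map_lie, lieDer_lie]; rfl

end Functoriality

/-! ### Cochains of top degree -/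

section TopDegree

variable {k L V : Type*} [Field k] [LieRing L] [LieAlgebra k L] [AddCommGroup V] [Module k V]

/-- The exterior product `α ∧ ω` of a linear form `α` and an `n`-cochain `ω`:
`(α ∧ ω)(x_0, …, x_n) = ∑ i, (-1)^i α(x_i) ω(…, x̂_i, …)`. -/
def wedge (α : L →ₗ[k] k) (n : ℕ) : Cochain k L V n →ₗ[k] Cochain k L V (n + 1) where
  toFun ω := AlternatingMap.alternatizeUncurryFin (α.smulRight ω)
  map_add' ω η := by
    rw [← AlternatingMap.alternatizeUncurryFin_add]
    congr 1
    ext; simp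
  map_smul' c ω := by
    rw [RingHom.id_apply, ← AlternatingMap.alternatizeUncurryFin_smul]
    congr 1
    ext; simp [smul_comm c]

theorem wedge_apply (α : L →ₗ[k] k) {n : ℕ} (ω : Cochain k L V n) (v : Fin (n + 1) → L) :
    wedge α n ω v = ∑ i : Fin (n + 1), (-1) ^ (i : ℕ) • α (v i) • ω (i.removeNth v) := by
  simp [wedge, AlternatingMap.alternatizeUncurryFin_apply]

theorem contract_wedge_zero (α : L →ₗ[k] k) (x : L) (ω : Cochain k L V 0) :
    contract x (wedge α 0 ω) = α x • ω := by
  ext v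
  rw [AlternatingMap.curryLeft_apply_apply, wedge_apply]
  simp [Subsingleton.elim (Fin.removeNth 0 (Matrix.vecCons x v)) v]

theorem contract_wedge (α : L →ₗ[k] k) (x : L) {n : ℕ} (ω : Cochain k L V (n + 1)) :
    contract x (wedge α (n + 1) ω) = α x • ω - wedge α n (contract x ω) := by
  ext v
  have hrem : ∀ j : Fin (n + 1), (Fin.removeNth j.succ (Fin.cons x v : Fin (n + 2) → L)) =
      Fin.cons x (j.removeNth v) := by
    intro j
    ext l
    refine Fin.cases ?_ (fun l => ?_) l <;> simp [Fin.removeNth]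
  have h0 : Fin.removeNth 0 (Fin.cons x v : Fin (n + 2) → L) = v := by
    ext l; simp [Fin.removeNth]
  rw [AlternatingMap.curryLeft_apply_apply, wedge_apply, Fin.sum_univ_succ, AlternatingMap.sub_apply,
    wedge_apply, Matrix.vecCons, h0, sub_eq_add_neg, ← Finset.sum_neg_distrib]
  congr 1
  · simp
  · refine Finset.sum_congr rfl fun j _ => ?_
    rw [hrem]
    simp [pow_succ, Matrix.vecCons]

theorem eq_zero_of_finrank_lt [FiniteDimensional k L] {n : ℕ} (h : Module.finrank k L < n)
    (ω : Cochain k L V n) : ω = 0 := by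
  ext v
  refine AlternatingMap.map_linearDependent ω v fun hli => ?_
  have := hli.fintype_card_le_finrank
  rw [Fintype.card_fin] at this
  omega

theorem ext_basis {m : ℕ} (e : Module.Basis (Fin m) k L) {ω η : Cochain k L V m}
    (h : ω e = η e) : ω = η := by
  refine Module.Basis.ext_alternating e fun v hv => ?_
  let σ : Equiv.Perm (Fin m) := Equiv.ofBijective v (Finite.injective_iff_bijective.mp hv)
  have h2 : (fun j => e (v j)) = e ∘ σ := rfl
  rw [h2, AlternatingMap.map_perm, AlternatingMap.map_perm, h]

/-- An endomorphism `A` of an `m`-dimensional space acts on `m`-cochains by `-tr A`. -/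
theorem lieDer_top {m : ℕ} (e : Module.Basis (Fin m) k L) (A : Module.End k L)
    (ω : Cochain k L V m) : lieDer A 0 m ω = -(LinearMap.trace k L A • ω) := by
  refine ext_basis e ?_
  rw [lieDer_apply, LinearMap.zero_apply, zero_sub, AlternatingMap.neg_apply, neg_inj,
    AlternatingMap.smul_apply, LinearMap.trace_eq_matrix_trace k e A, Matrix.trace, Finset.sum_smul]
  refine Finset.sum_congr rfl fun j _ => ?_
  rw [Matrix.diag_apply, LinearMap.toMatrix_apply]
  conv_lhs => rw [← e.sum_repr (A (e j))]
  -- Only the component of `A e_j` along `e_j` survives; the others repeat a basis vector.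
  rw [AlternatingMap.map_update_sum, Finset.sum_eq_single j]
  · rw [AlternatingMap.map_update_smul, Function.update_eq_self]
  · intro l _ hl
    rw [AlternatingMap.map_update_smul]
    rw [ω.map_eq_zero_of_eq (i := j) (j := l) _ (by simp [hl]) hl.symm, smul_zero]
  · simp

/-- Every cochain of degree one below the top is a sum of interior products of cochains of top
degree. This is Euler's formula: `∑ j, e_j^* ∧ ι_{e_j}` is multiplication by the degree. -/
theorem sum_contract_wedge {n : ℕ} (e : Module.Basis (Fin (n + 1)) k L) (η : Cochain k L V n) :
    ∑ j, contract (e j) (wedge (e.coord j) n η) = η := by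
  cases n with
  | zero => simp [contract_wedge_zero]
  | succ n =>
    have h : ∑ j, wedge (e.coord j) n (contract (e j) η) = (n + 1) • η := by
      rw [← AlternatingMap.alternatizeUncurryFin_curryLeft]
      have : AlternatingMap.curryLeft η =
          ∑ j, (e.coord j).smulRight (AlternatingMap.curryLeft η (e j)) := by
        refine e.ext fun l => ?_
        simp [LinearMap.sum_apply, Finsupp.single_apply]
      conv_rhs => rw [this]
      exact (map_sum AlternatingMap.alternatizeUncurryFinLM _ _).symm
    simp only [contract_wedge, Finset.sum_sub_distrib, h]
    simp [add_smul]

/-- On an `n + 1`-dimensional unimodular Lie algebra acting trivially on `V`, the differential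
from degree `n` to the top degree `n + 1` is zero: every `n`-cochain is a sum of interior products
`ι_x ζ` with `ζ` of top degree, and `d ι_x ζ = L_x ζ = -tr(ad x) ζ = 0`. -/
theorem d_eq_zero_of_unimodular {n : ℕ} (e : Module.Basis (Fin (n + 1)) k L)
    (ρ : L →ₗ⁅k⁆ Module.End k V) (hρ : ∀ x, ρ x = 0)
    (hL : ∀ x, LinearMap.trace k L (LieAlgebra.ad k L x) = 0) (η : Cochain k L V n) :
    d ρ n η = 0 := by
  have : FiniteDimensional k L := e.finiteDimensional_of_finite
  rw [← sum_contract_wedge e η, map_sum]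
  refine Finset.sum_eq_zero fun j _ => ?_
  have h := contract_d ρ (wedge (e.coord j) n η) (e j)
  -- The remaining term `ι_{e_j} d ζ` of Cartan's formula vanishes, since `d ζ` is above top degree.
  rw [hρ, lieDer_top e, hL, zero_smul, neg_zero, zero_sub, eq_zero_of_finrank_lt _ (d ρ (n + 1) _)]
    at h
  · rw [← neg_eq_zero, ← h]; rfl
  · rw [Module.finrank_eq_card_basis e, Fintype.card_fin]; omega

end TopDegree

/-! ### Components of cochains of a semidirect product -/

section Mixed

/-- The identification of `{0, …, q + p - 1}` with the disjoint union of its first `p` and its last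
`q` elements. -/
def blockEquiv (q p : ℕ) : Fin (q + p) ≃ Fin p ⊕ Fin q :=
  (finCongr (Nat.add_comm q p)).trans finSumFinEquiv.symm

theorem blockEquiv_zero (q p : ℕ) : blockEquiv q (p + 1) (0 : Fin (q + p + 1)) = Sum.inl 0 := by
  rw [← Equiv.eq_symm_apply]
  ext
  simp [blockEquiv]

theorem blockEquiv_succ (q p : ℕ) (j : Fin (q + p)) :
    blockEquiv q (p + 1) (Fin.succ j : Fin (q + p + 1)) =
      Sum.map Fin.succ id (blockEquiv q p j) := by
  obtain ⟨t, rfl⟩ := (blockEquiv q p).symm.surjective j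
  rw [← Equiv.eq_symm_apply, Equiv.apply_symm_apply]
  rcases t with t | t
  · ext; simp [blockEquiv]
  · ext; simp [blockEquiv]; omega

variable {k N G H M : Type*} [Field k] [LieRing N] [LieAlgebra k N] [LieRing G] [LieAlgebra k G]
  [LieRing H] [LieAlgebra k H] [AddCommGroup M] [Module k M]

/-- The component of a `(q + p)`-cochain of `G` in `C^p(H, C^q(N, M))`:
`(x_1, …, x_p) ↦ (y_1, …, y_q) ↦ ω(s x_1, …, s x_p, i y_1, …, i y_q)`. -/
def mixed (i : N →ₗ⁅k⁆ G) (s : H →ₗ⁅k⁆ G) (q p : ℕ) :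
    Cochain k G M (q + p) →ₗ[k] Cochain k H (Cochain k N M q) p where
  toFun ω :=
    { toFun := fun x =>
        { toFun := fun y => ω (Sum.elim (s ∘ x) (i ∘ y) ∘ blockEquiv q p)
          map_update_add' := by
            intro inst y j a b
            obtain rfl : inst = instDecidableEqFin q := Subsingleton.elim _ _
            simp only [Function.comp_update, ← Sum.update_elim_inr, Function.update_comp_equiv,
              map_add, AlternatingMap.map_update_add]
          map_update_smul' := by
            intro inst y j c a
            obtain rfl : inst = instDecidableEqFin q := Subsingleton.elim _ _
            simp only [Function.comp_update, ← Sum.update_elim_inr, Function.update_comp_equiv,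
              map_smul, AlternatingMap.map_update_smul]
          map_eq_zero_of_eq' := by
            intro y j l hy hjl
            refine ω.map_eq_zero_of_eq (i := (blockEquiv q p).symm (Sum.inr j))
              (j := (blockEquiv q p).symm (Sum.inr l)) _ (by simp [hy]) (by simpa using hjl) }
      map_update_add' := by
        intro inst x j a b
        obtain rfl : inst = instDecidableEqFin p := Subsingleton.elim _ _
        ext y
        simp only [Function.comp_update, ← Sum.update_elim_inl, Function.update_comp_equiv,
          map_add, AlternatingMap.map_update_add, AlternatingMap.add_apply, AlternatingMap.coe_mk,
          MultilinearMap.coe_mk]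
      map_update_smul' := by
        intro inst x j c a
        obtain rfl : inst = instDecidableEqFin p := Subsingleton.elim _ _
        ext y
        simp only [Function.comp_update, ← Sum.update_elim_inl, Function.update_comp_equiv,
          map_smul, AlternatingMap.map_update_smul, AlternatingMap.smul_apply,
          AlternatingMap.coe_mk, MultilinearMap.coe_mk]
      map_eq_zero_of_eq' := by
        intro x j l hx hjl
        ext y
        refine ω.map_eq_zero_of_eq (i := (blockEquiv q p).symm (Sum.inl j))
              (j := (blockEquiv q p).symm (Sum.inl l)) _ (by simp [hx]) (by simpa using hjl) }
  map_add' ω η := rfl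
  map_smul' c ω := rfl

variable (i : N →ₗ⁅k⁆ G) (s : H →ₗ⁅k⁆ G)

theorem mixed_apply {q p : ℕ} (ω : Cochain k G M (q + p)) (x : Fin p → H) (y : Fin q → N) :
    mixed i s q p ω x y = ω (Sum.elim (s ∘ x) (i ∘ y) ∘ blockEquiv q p) := rfl

theorem mixed_zero_apply {q : ℕ} (ω : Cochain k G M (q + 0)) (x : Fin 0 → H) :
    mixed i s q 0 ω x = AlternatingMap.compLinearMap (ι := Fin q) ω (i : N →ₗ[k] G) := by
  ext y
  rw [mixed_apply]
  refine congrArg ω (funext fun j => ?_)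
  obtain ⟨t, rfl⟩ := (blockEquiv q 0).symm.surjective j
  rcases t with t | t
  · exact t.elim0
  · rw [Function.comp_apply, Equiv.apply_symm_apply]
    change i (y t) = i (y _)
    congr 2
    ext
    simp [blockEquiv]

/-- Interior products with `s x` act on the first factor. This, with `mixed_zero_apply`, determines
`mixed` recursively. -/
theorem contract_mixed {q p : ℕ} (ω : Cochain k G M (q + (p + 1))) (x : H) :
    contract x (mixed i s q (p + 1) ω) =
      mixed i s q p (contract (n := q + p) (s x) ω) := by
  ext v y
  rw [AlternatingMap.curryLeft_apply_apply, mixed_apply, mixed_apply,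
    AlternatingMap.curryLeft_apply_apply]
  refine congrArg ω (funext fun j => ?_)
  refine Fin.cases (n := q + p) ?_ (fun j => ?_) j
  · rw [Function.comp_apply, blockEquiv_zero]
    simp
  · rw [Function.comp_apply, blockEquiv_succ]
    rcases h : blockEquiv q p j with t | t <;> simp [h, Matrix.vecCons]

variable (δ : H →ₗ⁅k⁆ Module.End k N) (ρ : G →ₗ⁅k⁆ Module.End k M)

/-- If `s x` acts on the ideal `N` through `δ x`, taking components is equivariant. -/
theorem mixed_lieDer (hδ : ∀ x y, i (δ x y) = ⁅s x, i y⁆) {q p : ℕ} (x : H)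
    (ω : Cochain k G M (q + p)) :
    mixed i s q p (lieDer (LieAlgebra.ad k G (s x)) (ρ (s x)) (q + p) ω) =
      lieDer (LieAlgebra.ad k H x) (cochainRep δ (ρ.comp s) q x) p (mixed i s q p ω) := by
  induction p with
  | zero =>
    refine AlternatingMap.ext fun v => ?_
    rw [mixed_zero_apply, lieDer_apply, Finset.univ_eq_empty, Finset.sum_empty, sub_zero,
      mixed_zero_apply]
    exact lieDer_compLinearMap (n := q) (i : N →ₗ[k] G) _ (δ x) (hδ x) _ ω
  | succ p ih =>
    refine contract_ext fun z => ?_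
    rw [contract_mixed, contract_lieDer, contract_mixed, LieAlgebra.ad_apply, contract_mixed]
    refine (congrArg _ (contract_lieDer (n := q + p) _ _ ω (s z))).trans ?_
    rw [map_sub, ih, LieAlgebra.ad_apply, LieHom.map_lie]

/-- If the differential of `C^*(N, M)` vanishes in degree `q - 1`, then the component in
`C^{p+1}(H, C^q(N, M))` of a coboundary `d ω` of `G` is the coboundary over `H` of the component of
`ω` in `C^p(H, C^q(N, M))`. -/
theorem mixed_d (hδ : ∀ x y, i (δ x y) = ⁅s x, i y⁆) {q : ℕ}
    (hq : coboundaries (ρ.comp i) q = ⊥) {p : ℕ} (ω : Cochain k G M (q + p)) :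
    mixed i s q (p + 1) (d ρ (q + p) ω) =
      d (cochainRep δ (ρ.comp s) q) p (mixed i s q p ω) := by
  induction p with
  | zero =>
    refine contract_ext fun x => ?_
    rw [contract_mixed, contract_d_zero, ← mixed_lieDer i s δ ρ hδ]
    cases q with
    | zero => exact congrArg _ (contract_d_zero ρ ω (s x))
    | succ q =>
      refine (congrArg _ (contract_d (n := q) ρ ω (s x))).trans ?_
      refine (map_sub (mixed i s (q + 1) 0) _ _).trans (sub_eq_self.mpr ?_)
      refine AlternatingMap.ext fun v => ?_
      rw [mixed_zero_apply]
      have h : (d ρ q (contract (s x) ω)).compLinearMap (i : N →ₗ[k] G) ∈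
          coboundaries (ρ.comp i) (q + 1) := ⟨_, d_compLinearMap ρ i (contract (s x) ω)⟩
      rw [hq] at h
      exact h
  | succ p ih =>
    refine contract_ext fun x => ?_
    rw [contract_mixed, contract_d, contract_mixed, ← mixed_lieDer i s δ ρ hδ, ← ih]
    exact (congrArg _ (contract_d (n := q + p) ρ ω (s x))).trans (map_sub (mixed i s q (p + 1)) _ _)

end Mixed

/-! ### Exterior products with several linear forms -/

section Wedge

variable {k L V : Type*} [Field k] [LieRing L] [LieAlgebra k L] [AddCommGroup V] [Module k V]

theorem wedge_mem_vanishing {S : Submodule k L} {α : L →ₗ[k] k} (hα : ∀ x ∈ S, α x = 0) {b n : ℕ}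
    {ω : Cochain k L V n} (h : ω ∈ vanishing V S b n) :
    wedge α n ω ∈ vanishing V S b (n + 1) := by
  intro v T hT hv
  rw [wedge_apply]
  refine Finset.sum_eq_zero fun j _ => ?_
  by_cases hj : j ∈ T
  · rw [hα _ (hv j hj), zero_smul, smul_zero]
  · rw [h _ (Finset.univ.filter fun i : Fin n => j.succAbove i ∈ T), smul_zero, smul_zero]
    · rwa [card_filter_succAbove_mem, Finset.erase_eq_of_notMem hj]
    · intro a ha
      exact hv _ (Finset.mem_filter.mp ha).2

variable (k L V) in
/-- Transport of cochains along an equality of degrees. -/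
def degreeCast {n n' : ℕ} (h : n = n') : Cochain k L V n →ₗ[k] Cochain k L V n' :=
  (AlternatingMap.domDomCongrₗ k (finCongr h)).toLinearMap

theorem degreeCast_mem_vanishing {S : Submodule k L} {b n n' : ℕ} (h : n = n')
    {ω : Cochain k L V n} (hω : ω ∈ vanishing V S b n) :
    degreeCast k L V h ω ∈ vanishing V S b n' := by
  subst h
  exact hω

theorem contract_degreeCast {n n' : ℕ} (h : n + 1 = n' + 1) (ω : Cochain k L V (n + 1)) (x : L) :
    contract x (degreeCast k L V h ω) =
      degreeCast k L V (Nat.succ_injective h) (contract x ω) := by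
  obtain rfl := Nat.succ_injective h
  rfl

/-- The exterior product `α_{m-1} ∧ … ∧ α_0 ∧ ω`. -/
def wedgeAll (α : ℕ → L →ₗ[k] k) (p : ℕ) :
    ∀ m : ℕ, Cochain k L V p →ₗ[k] Cochain k L V (m + p)
  | 0 => degreeCast k L V (Nat.zero_add p).symm
  | m + 1 => degreeCast k L V (Nat.add_right_comm m p 1) ∘ₗ wedge (α m) (m + p) ∘ₗ wedgeAll α p m

theorem wedgeAll_mem_vanishing {S : Submodule k L} {α : ℕ → L →ₗ[k] k}
    (hα : ∀ j, ∀ x ∈ S, α j x = 0) {b p : ℕ} (m : ℕ) {ω : Cochain k L V p}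
    (h : ω ∈ vanishing V S b p) : wedgeAll α p m ω ∈ vanishing V S b (m + p) := by
  induction m with
  | zero => exact degreeCast_mem_vanishing _ h
  | succ m ih => exact degreeCast_mem_vanishing _ (wedge_mem_vanishing (hα m) ih)

/-- The sign is `(-1)^m`; only its independence of `x` and `ω` matters. -/
theorem contract_wedgeAll (α : ℕ → L →ₗ[k] k) (p m : ℕ) :
    ∃ ε : ℤˣ, ∀ x : L, (∀ j, α j x = 0) → ∀ ω : Cochain k L V (p + 1),
      contract (n := m + p) x (wedgeAll α (p + 1) m ω) = ε • wedgeAll α p m (contract x ω) := by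
  induction m with
  | zero =>
    refine ⟨1, fun x _ ω => ?_⟩
    rw [one_smul]
    exact contract_degreeCast (n' := 0 + p) _ ω x
  | succ m ih =>
    obtain ⟨ε, hε⟩ := ih
    refine ⟨-ε, fun x hα ω => ?_⟩
    have h : contract x (wedge (α m) (m + (p + 1)) (wedgeAll α (p + 1) m ω)) =
        -(ε • wedge (α m) (m + p) (wedgeAll α p m (contract x ω))) := by
      refine (contract_wedge (n := m + p) (α m) x _).trans ?_
      rw [hα, zero_smul, zero_sub, hε x hα]
      simp only [Units.smul_def, map_zsmul]
    refine (contract_degreeCast (n := m + (p + 1)) (n' := m + 1 + p) _ _ x).trans ?_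
    refine (congrArg _ h).trans ?_
    simp only [Units.smul_def, map_neg, map_zsmul, Units.val_neg, neg_smul]
    rfl

theorem wedgeAll_zero_apply (α : ℕ → L →ₗ[k] k) (m : ℕ) :
    ∃ ε : ℤˣ, ∀ (ω : Cochain k L V 0) (v : ℕ → L),
      (∀ j < m, ∀ l < m, α j (v l) = if j = l then 1 else 0) →
      wedgeAll α 0 m ω (fun j : Fin m => v j) = ε • ω 0 := by
  induction m with
  | zero =>
    refine ⟨1, fun ω v hv => ?_⟩
    rw [one_smul]
    exact congrArg ω (Subsingleton.elim _ _)
  | succ m ih =>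
    obtain ⟨ε, hε⟩ := ih
    refine ⟨(-1) ^ m * ε, fun ω v hv => ?_⟩
    change wedge (α m) m (wedgeAll α 0 m ω) (fun j : Fin (m + 1) => v j) = _
    rw [wedge_apply, Finset.sum_eq_single (Fin.last m)]
    · rw [Fin.val_last, hv m m.lt_succ_self m m.lt_succ_self, if_pos rfl, one_smul, mul_smul,
        ← hε ω v fun j hj l hl => hv j (hj.trans m.lt_succ_self) l (hl.trans m.lt_succ_self)]
      have : Fin.removeNth (Fin.last m) (fun j : Fin (m + 1) => v j) = fun j : Fin m => v j := by
        funext j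
        simp [Fin.removeNth]
      rw [this]
      simp [Units.smul_def]
    · intro j _ hj
      rw [hv m m.lt_succ_self j j.isLt, if_neg, zero_smul, smul_zero]
      intro h
      exact hj (Fin.ext h.symm)
    · simp

end Wedge

/-! ### The component of top degree along the ideal -/

section Split

variable {k N G H M : Type*} [Field k] [LieRing N] [LieAlgebra k N] [LieRing G] [LieAlgebra k G]
  [LieRing H] [LieAlgebra k H] [AddCommGroup M] [Module k M]
  (i : N →ₗ⁅k⁆ G) (s : H →ₗ⁅k⁆ G)

theorem mem_vanishing_range_succ {m : ℕ} (e : Module.Basis (Fin m) k N) {n : ℕ}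
    (ω : Cochain k G M n) : ω ∈ vanishing M (LinearMap.range (i : N →ₗ[k] G)) (m + 1) n := by
  have : FiniteDimensional k N := e.finiteDimensional_of_finite
  refine mem_vanishing_of_finrank_lt (Nat.lt_succ_of_le ?_) ω
  refine (LinearMap.finrank_range_le _).trans ?_
  rw [Module.finrank_eq_card_basis e, Fintype.card_fin]

theorem mem_vanishing_range_of_compLinearMap {m : ℕ} {ω : Cochain k G M m}
    (h : ω.compLinearMap (i : N →ₗ[k] G) = 0) :
    ω ∈ vanishing M (LinearMap.range (i : N →ₗ[k] G)) m m := by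
  intro v T hT hv
  have hu : T = Finset.univ := by
    refine Finset.eq_univ_of_card T (le_antisymm T.card_le_univ ?_)
    rwa [Fintype.card_fin]
  choose y hy using fun j => hv j (hu ▸ Finset.mem_univ j)
  obtain rfl : (fun j => i (y j)) = v := funext hy
  exact congrArg (fun f => f y) h

/-- The component in `C^p(H, C^m(N, M))`, `m = dim N`, is zero exactly for the cochains in
`F^{p+1}`. -/
theorem mixed_eq_zero_iff {m : ℕ} (e : Module.Basis (Fin m) k N)
    (hsup : LinearMap.range (i : N →ₗ[k] G) ⊔ LinearMap.range (s : H →ₗ[k] G) = ⊤) {p : ℕ}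
    {ω : Cochain k G M (m + p)} :
    mixed i s m p ω = 0 ↔ ω ∈ vanishing M (LinearMap.range (i : N →ₗ[k] G)) m (m + p) := by
  constructor
  · intro h
    induction p with
    | zero =>
      refine mem_vanishing_range_of_compLinearMap i (m := m) ?_
      rw [← mixed_zero_apply i s ω 0, h]
      rfl
    | succ p ih =>
      refine mem_vanishing_of_contract (n := m + p) (Nat.le_add_right m p) fun x => ?_
      obtain ⟨y, hy, _, ⟨z, rfl⟩, rfl⟩ := Submodule.mem_sup.mp (hsup ▸ Submodule.mem_top : x ∈ _)
      rw [contract_add]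
      refine Submodule.add_mem _
        (mem_vanishing_succ_iff.mp (mem_vanishing_range_succ i e ω) y hy) (ih ?_)
      rw [LieHom.coe_toLinearMap, ← contract_mixed, h]
      rfl
  · intro h
    ext x y
    rw [mixed_apply, h _ (Finset.univ.map
      (Function.Embedding.inr.trans (blockEquiv m p).symm.toEmbedding))]
    · rfl
    · simp
    · intro j hj
      obtain ⟨l, -, rfl⟩ := Finset.mem_map.mp hj
      simp

/-- Every element of `C^p(H, C^m(N, M))`, where `m = dim N`, is the component of an
`(m + p)`-cochain of `G` whose other components all vanish: up to sign, the exterior product of a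
`p`-cochain of `H` with the form on `G` extending a volume form of `N` by zero on `H`. -/
theorem exists_mixed_eq {m : ℕ} (e : Module.Basis (Fin m) k N) (π : G →ₗ[k] H) (τ : G →ₗ[k] N)
    (hπs : ∀ x, π (s x) = x) (hτi : ∀ y, τ (i y) = y) (hτs : ∀ x, τ (s x) = 0) {p : ℕ}
    (c : Cochain k H (Cochain k N M m) p) :
    ∃ ω ∈ vanishing M (LinearMap.range (s : H →ₗ[k] G)) (p + 1) (m + p), mixed i s m p ω = c := by
  -- The linear forms on `G` that extend the dual basis of `N` by zero on `H`.
  let α : ℕ → G →ₗ[k] k := fun j => if h : j < m then e.coord ⟨j, h⟩ ∘ₗ τ else 0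
  have hα : ∀ j x, α j (s x) = 0 := fun j x => by
    simp only [α]
    split_ifs
    · rw [LinearMap.comp_apply, hτs, map_zero]
    · rfl
  let ev : Cochain k N M m →ₗ[k] M :=
    { toFun := fun η => η e, map_add' := fun _ _ => rfl, map_smul' := fun _ _ => rfl }
  let E : ∀ {p : ℕ}, Cochain k H (Cochain k N M m) p → Cochain k G M (m + p) :=
    fun c => wedgeAll α _ m ((ev.compAlternatingMap c).compLinearMap π)
  -- Up to a sign, `E` is a section of `mixed`.
  have key : ∀ p, ∃ ε : ℤˣ, ∀ c : Cochain k H (Cochain k N M m) p, mixed i s m p (E c) = ε • c := by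
    intro p
    induction p with
    | zero =>
      obtain ⟨ε, hε⟩ : ∃ ε : ℤˣ, ∀ ω : Cochain k G M 0,
          wedgeAll α 0 m ω (fun j : Fin m => i (e j)) = ε • ω 0 := by
        obtain ⟨ε, hε⟩ := wedgeAll_zero_apply (V := M) α m
        refine ⟨ε, fun ω => ?_⟩
        rw [← hε ω (fun l => if h : l < m then i (e ⟨l, h⟩) else 0) fun j hj l hl => ?_]
        · simp
        · simp [α, hj, hl, hτi, Finsupp.single_apply, eq_comm]
      refine ⟨ε, fun c => AlternatingMap.ext fun v => ext_basis e ?_⟩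
      rw [mixed_zero_apply]
      refine (hε _).trans ?_
      exact congrArg (fun u => (ε : ℤ) • c u e) (Subsingleton.elim (fun j => π _) v)
    | succ p ih =>
      obtain ⟨ε, hε⟩ := ih
      obtain ⟨ε', hε'⟩ := contract_wedgeAll (V := M) α p m
      refine ⟨ε' * ε, fun c => contract_ext fun x => ?_⟩
      have h1 : contract (s x) ((ev.compAlternatingMap c).compLinearMap π) =
          (ev.compAlternatingMap (contract x c)).compLinearMap π := by
        rw [contract, AlternatingMap.curryLeft_compLinearMap, hπs,
          AlternatingMap.curryLeft_compAlternatingMap]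
      rw [contract_mixed]
      refine (congrArg _ (hε' (s x) (fun j => hα j x) _)).trans ?_
      rw [h1, Units.smul_def, map_zsmul]
      refine (congrArg _ (hε (contract x c))).trans ?_
      simp only [Units.smul_def, mul_smul]
      rfl
  obtain ⟨ε, hε⟩ := key p
  refine ⟨ε⁻¹ • E c, ?_, ?_⟩
  · rw [Units.smul_def]
    refine zsmul_mem (wedgeAll_mem_vanishing ?_ m (mem_vanishing_of_lt (Nat.lt_succ_self p) _)) _
    rintro j _ ⟨x, rfl⟩
    exact hα j x
  · rw [Units.smul_def, map_zsmul, hε, ← Units.smul_def, inv_smul_smul]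

/-- An element `x` of the ideal `N` acts on the component of a cochain in `C^p(H, C^m(N, M))`,
`m = dim N`, by `-tr(ad x)`: it maps the arguments from `H` into `N`, so that only its action on the
arguments from `N` contributes. -/
theorem lieDer_add_trace_smul_mem_vanishing {m : ℕ} (e : Module.Basis (Fin m) k N)
    (hN : ∀ x y, ⁅i x, y⁆ ∈ LinearMap.range (i : N →ₗ[k] G)) (x : N) {n : ℕ}
    (ω : Cochain k G M n) :
    lieDer (LieAlgebra.ad k G (i x)) 0 n ω + LinearMap.trace k N (LieAlgebra.ad k N x) • ω ∈
      vanishing M (LinearMap.range (i : N →ₗ[k] G)) m n := by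
  rcases lt_or_ge n m with h | h
  · exact mem_vanishing_of_lt h _
  obtain ⟨p, rfl⟩ := Nat.exists_eq_add_of_le h
  induction p with
  | zero =>
    refine mem_vanishing_range_of_compLinearMap i (m := m) ?_
    refine (congrArg₂ (· + ·) ((lieDer_compLinearMap (n := m) (i : N →ₗ[k] G) _
      (LieAlgebra.ad k N x) (fun y => ?_) 0 ω).trans (lieDer_top e _ _)) rfl).trans
      (neg_add_cancel _)
    simp
  | succ p ih =>
    refine mem_vanishing_of_contract (n := m + p) (Nat.le_add_right m p) fun z => ?_
    have h1 := ih (contract (n := m + p) z ω) (Nat.le_add_right m p)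
    have h2 := mem_vanishing_succ_iff.mp (mem_vanishing_range_succ (n := m + p + 1) i e ω) _ (hN x z)
    have h3 := Submodule.sub_mem _ h1 h2
    refine (congrArg (· ∈ _) ?_).mpr h3
    have h4 := contract_lieDer (n := m + p) (LieAlgebra.ad k G (i x)) 0 ω z
    rw [LieAlgebra.ad_apply] at h4
    rw [← sub_add_eq_add_sub, ← h4]
    rfl

/-- If `N` is not unimodular, every cochain of positive degree differs by a coboundary from one
whose component in `C^p(H, C^m(N, M))`, `m = dim N`, vanishes. -/
theorem exists_mem_vanishing_d_eq {m : ℕ} (e : Module.Basis (Fin m) k N)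
    (hN : ∀ x y, ⁅i x, y⁆ ∈ LinearMap.range (i : N →ₗ[k] G)) (ρ : G →ₗ⁅k⁆ Module.End k M)
    (hρ : ∀ y, ρ (i y) = 0) {x : N} (hx : LinearMap.trace k N (LieAlgebra.ad k N x) ≠ 0) {n : ℕ}
    (hn : n ≠ 0) (ω : Cochain k G M n) :
    ∃ ω' ∈ vanishing M (LinearMap.range (i : N →ₗ[k] G)) m n, d ρ n ω' = d ρ n ω := by
  obtain ⟨n, rfl⟩ := Nat.exists_eq_succ_of_ne_zero hn
  set t := LinearMap.trace k N (LieAlgebra.ad k N x) with ht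
  -- By Cartan's formula `d ι_x ω = L_x ω - ι_x d ω`, where `L_x ω` is `-t ω` up to `F^{p+1}` and
  -- `ι_x d ω` lies in `F^{p+1}`.
  refine ⟨ω + d ρ n (t⁻¹ • contract (i x) ω), ?_, by rw [map_add, d_d, add_zero]⟩
  have h1 := lieDer_add_trace_smul_mem_vanishing i e hN x ω
  have h2 := mem_vanishing_succ_iff.mp (mem_vanishing_range_succ i e (d ρ (n + 1) ω)) _ ⟨x, rfl⟩
  have h3 := contract_d ρ ω (i x)
  rw [hρ] at h3
  have h4 := Submodule.smul_mem _ t⁻¹ (Submodule.sub_mem _ h1 h2)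
  refine (congrArg (· ∈ _) ?_).mpr h4
  rw [LieHom.coe_toLinearMap, h3, ← ht, map_smul, smul_sub, smul_sub, smul_add, smul_smul,
    inv_mul_cancel₀ hx, one_smul]
  abel

end Split

/-! ### The Hochschild–Serre filtration -/

section Filtration

variable {k G M : Type*} [Field k] [LieRing G] [LieAlgebra k G] [AddCommGroup M] [Module k M]

theorem hsFiltration_le_vanishing {I : LieIdeal k G} {p : ℤ} {n b : ℕ} (h : (n : ℤ) - p + 1 ≤ b) :
    hsFiltration M I p n ≤ vanishing M I.toSubmodule b n :=
  fun _ hω v T hT hv => hω v T (h.trans (by exact_mod_cast hT)) hv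

theorem vanishing_le_hsFiltration {I : LieIdeal k G} {p : ℤ} {n b : ℕ} (h : b ≤ (n : ℤ) - p + 1) :
    vanishing M I.toSubmodule b n ≤ hsFiltration M I p n :=
  fun _ hω v T hT hv => hω v T (by exact_mod_cast h.trans hT) hv

/-- The differential `d_r^{p,q}` vanishes if each cochain in `Z_r^{p,q}` has the same coboundary as
some cochain in `F^{p+1}`. -/
theorem hsDiff_eq_zero {ρ : G →ₗ⁅k⁆ Module.End k M} {I : LieIdeal k G} {r : ℕ} {p : ℤ} {n : ℕ}
    (h : ∀ ω ∈ hsZ ρ I r p n, ∃ ω' ∈ hsFiltration M I (p + 1) n, d ρ n ω' = d ρ n ω) :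
    hsDiff ρ I r p n = 0 := by
  refine Submodule.linearMap_qext _ (LinearMap.ext ?_)
  rintro ⟨ω, hω⟩
  refine (Submodule.Quotient.mk_eq_zero _).mpr ?_
  obtain ⟨ω', h1, h2⟩ := h ω hω
  change d ρ n ω ∈ hsZ ρ I (r - 1) (p + r + 1) (n + 1) ⊔ hsB ρ I (r - 1) (p + r) (n + 1)
  refine Submodule.mem_sup_right ⟨hω.2, ω', ?_, h2⟩
  rwa [show p + (r : ℤ) - ((r : ℤ) - 1) = p + 1 by ring]

end Filtration

/-! ### Maps induced on cohomology -/

section CohomologyMap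

variable {k L L' V V' : Type*} [Field k] [LieRing L] [LieAlgebra k L] [LieRing L']
  [LieAlgebra k L'] [AddCommGroup V] [Module k V] [AddCommGroup V'] [Module k V']

theorem cohomology_mk_eq_zero_iff {ρ : L →ₗ⁅k⁆ Module.End k V} {n : ℕ} (ω : cocycles ρ n) :
    (Submodule.Quotient.mk ω : Cohomology ρ n) = 0 ↔ ω.1 ∈ coboundaries ρ n :=
  Submodule.Quotient.mk_eq_zero _

/-- The map induced on cohomology by a linear map of cochains that preserves cocycles and
coboundaries. -/
def cohomologyMap (ρ : L →ₗ⁅k⁆ Module.End k V) (ρ' : L' →ₗ⁅k⁆ Module.End k V') {n n' : ℕ}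
    (f : Cochain k L V n →ₗ[k] Cochain k L' V' n')
    (hc : ∀ ω, d ρ n ω = 0 → d ρ' n' (f ω) = 0)
    (hb : ∀ ω ∈ coboundaries ρ n, f ω ∈ coboundaries ρ' n') :
    Cohomology ρ n →ₗ[k] Cohomology ρ' n' :=
  Submodule.mapQ _ _ (f.restrict (p := cocycles ρ n) (q := cocycles ρ' n') hc)
    (fun ω hω => hb ω.1 hω)

end CohomologyMap

/-! ### Split extensions -/

section Extension

variable {k N G H M : Type*} [Field k] [LieRing N] [LieAlgebra k N] [LieRing G] [LieAlgebra k G]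
  [LieRing H] [LieAlgebra k H] [AddCommGroup M] [Module k M]
  (i : N →ₗ⁅k⁆ G) (π : G →ₗ⁅k⁆ H) [LieAlgebra.IsExtension i π] (s : H →ₗ⁅k⁆ G)

theorem ker_toSubmodule_eq_range : π.ker.toSubmodule = LinearMap.range (i : N →ₗ[k] G) := by
  have hex := (LieHom.range_eq_ker_iff i π).mp (LieAlgebra.IsExtension.exact (i := i) (p := π))
  ext x
  exact hex x

theorem proj_incl (y : N) : π (i y) = 0 :=
  ((LieHom.range_eq_ker_iff i π).mp (LieAlgebra.IsExtension.exact (i := i) (p := π)) _).mpr ⟨y, rfl⟩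

/-- The projection of `G` onto `N` along `s(H)`. -/
theorem exists_retraction (hs : ∀ x, π (s x) = x) :
    ∃ τ : G →ₗ[k] N, (∀ y, τ (i y) = y) ∧ (∀ x, τ (s x) = 0) ∧ ∀ x, i (τ x) + s (π x) = x := by
  have hmem : ∀ x, x - s (π x) ∈ LinearMap.range (i : N →ₗ[k] G) := fun x => by
    rw [← ker_toSubmodule_eq_range i π]
    change π _ = 0
    rw [map_sub, hs, sub_self]
  let τ : G →ₗ[k] N :=
    (LinearEquiv.ofInjective (i : N →ₗ[k] G) (incl_injective i π)).symm.toLinearMap ∘ₗ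
      LinearMap.codRestrict (LinearMap.range (i : N →ₗ[k] G))
        (LinearMap.id - (s : H →ₗ[k] G) ∘ₗ (π : G →ₗ[k] H)) hmem
  have hτ : ∀ x, i (τ x) = x - s (π x) := fun x =>
    LinearEquiv.ofInjective_symm_apply (i : N →ₗ[k] G) (h := incl_injective i π)
      (⟨x - s (π x), hmem x⟩ : LinearMap.range (i : N →ₗ[k] G))
  have hinj : ∀ {a b}, i a = i b → a = b := fun h => incl_injective i π h
  refine ⟨τ, fun y => hinj ?_, fun x => hinj ?_, fun x => ?_⟩
  · rw [hτ, proj_incl i π, map_zero, sub_zero]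
  · rw [hτ, hs, sub_self, map_zero]
  · rw [hτ, sub_add_cancel]

theorem range_sup_range (hs : ∀ x, π (s x) = x) :
    LinearMap.range (i : N →ₗ[k] G) ⊔ LinearMap.range (s : H →ₗ[k] G) = ⊤ := by
  obtain ⟨τ, -, -, h⟩ := exists_retraction i π s hs
  refine eq_top_iff.mpr fun x _ => Submodule.mem_sup.mpr ⟨i (τ x), ⟨_, rfl⟩, s (π x), ⟨_, rfl⟩, h x⟩

/-- A linear lift of `C^p(H, C^m(N, M))`, `m = dim N`, to the cochains of `G` whose other components
all vanish. -/
theorem exists_lift (hs : ∀ x, π (s x) = x) {m : ℕ} (e : Module.Basis (Fin m) k N) (p : ℕ) :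
    ∃ Φ : Cochain k H (Cochain k N M m) p →ₗ[k] Cochain k G M (m + p),
      (∀ c, mixed i s m p (Φ c) = c) ∧
      ∀ c, Φ c ∈ vanishing M (LinearMap.range (s : H →ₗ[k] G)) (p + 1) (m + p) := by
  obtain ⟨τ, hτi, hτs, -⟩ := exists_retraction i π s hs
  let W := vanishing M (LinearMap.range (s : H →ₗ[k] G)) (p + 1) (m + p)
  have hsurj : Function.Surjective ((mixed (M := M) i s m p).domRestrict W) := fun c => by
    obtain ⟨ω, h, hc⟩ := exists_mixed_eq i s e (π : G →ₗ[k] H) τ hs hτi hτs c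
    exact ⟨⟨ω, h⟩, hc⟩
  obtain ⟨Ψ, hΨ⟩ := LinearMap.exists_rightInverse_of_surjective _ (LinearMap.range_eq_top.mpr hsurj)
  exact ⟨W.subtype ∘ₗ Ψ, fun c => LinearMap.congr_fun hΨ c, fun c => (Ψ c).2⟩

/-- A cochain all of whose components outside `C^p(H, C^m(N, M))` vanish is determined by that
component. -/
theorem eq_of_mixed_eq (hs : ∀ x, π (s x) = x) {m : ℕ} (e : Module.Basis (Fin m) k N) {p : ℕ}
    {ω η : Cochain k G M (m + p)}
    (hω : ω ∈ vanishing M (LinearMap.range (s : H →ₗ[k] G)) (p + 1) (m + p))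
    (hη : η ∈ vanishing M (LinearMap.range (s : H →ₗ[k] G)) (p + 1) (m + p))
    (h : mixed i s m p ω = mixed i s m p η) : ω = η := by
  have hsup := range_sup_range i π s hs
  rw [← sub_eq_zero]
  refine eq_zero_of_mem_vanishing hsup (by omega)
    ((mixed_eq_zero_iff i s e hsup).mp ?_) (Submodule.sub_mem _ hω hη)
  rw [map_sub, h, sub_self]

variable (ρ : G →ₗ⁅k⁆ Module.End k M)

theorem incl_kernelRep_comp (x : H) (y : N) : i ((kernelRep i π).comp s x y) = ⁅s x, i y⁆ :=
  incl_kernelAd i π (s x) y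

theorem coboundaries_eq_bot {m : ℕ} (e : Module.Basis (Fin m) k N) (hρ : ∀ y, ρ (i y) = 0)
    (hN : ∀ y, LinearMap.trace k N (LieAlgebra.ad k N y) = 0) :
    coboundaries (ρ.comp i) m = ⊥ := by
  cases m with
  | zero => rfl
  | succ m =>
    exact LinearMap.range_eq_bot.mpr
      (LinearMap.ext fun η => d_eq_zero_of_unimodular e (ρ.comp i) hρ hN η)

/-- The lift of the row of top degree `m = dim N` to `C^*(G, M)` is a map of complexes over `H`
if the differential into that row vanishes. -/
theorem d_lift (hs : ∀ x, π (s x) = x) {m : ℕ} (e : Module.Basis (Fin m) k N)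
    (hcob : coboundaries (ρ.comp i) m = ⊥) {p : ℕ} {ω : Cochain k G M (m + p)}
    {η : Cochain k G M (m + (p + 1))}
    (hω : ω ∈ vanishing M (LinearMap.range (s : H →ₗ[k] G)) (p + 1) (m + p))
    (hη : η ∈ vanishing M (LinearMap.range (s : H →ₗ[k] G)) (p + 2) (m + (p + 1)))
    (h : mixed i s m (p + 1) η =
      d (cochainRep ((kernelRep i π).comp s) (ρ.comp s) m) p (mixed i s m p ω)) :
    d ρ (m + p) ω = η := by
  refine eq_of_mixed_eq i π s hs e (p := p + 1) (d_mem_vanishing ρ ?_ hω) hη ?_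
  · rintro _ ⟨x, rfl⟩ _ ⟨y, rfl⟩
    exact ⟨⁅x, y⁆, by simp⟩
  · rw [h]
    exact mixed_d i s _ ρ (incl_kernelRep_comp i π s) hcob ω

theorem lie_incl_mem_range (i : N →ₗ⁅k⁆ G) (π : G →ₗ⁅k⁆ H) [LieAlgebra.IsExtension i π]
    (x : N) (y : G) :
    ⁅i x, y⁆ ∈ LinearMap.range (i : N →ₗ[k] G) := by
  rw [← lie_skew]
  exact Submodule.neg_mem _ (lie_mem_range i π y x)

theorem hsDiff_top_row (hs : ∀ x, π (s x) = x) (hρ : ∀ y, ρ (i y) = 0) {m : ℕ}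
    (e : Module.Basis (Fin m) k N) {r : ℕ} (hr : 2 ≤ r) (p : ℕ) :
    hsDiff ρ π.ker r p (m + p) = 0 := by
  have hsup := range_sup_range i π s hs
  refine hsDiff_eq_zero fun ω hω => ?_
  suffices h : ∃ ω' ∈ vanishing M (LinearMap.range (i : N →ₗ[k] G)) m (m + p),
      d ρ (m + p) ω' = d ρ (m + p) ω by
    obtain ⟨ω', h1, h2⟩ := h
    rw [← ker_toSubmodule_eq_range i π] at h1
    exact ⟨ω', vanishing_le_hsFiltration (by push_cast; linarith) h1, h2⟩
  by_cases hN : ∀ y, LinearMap.trace k N (LieAlgebra.ad k N y) = 0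
  · -- The component of `ω` is a cocycle over `H`, because `d ω` lies in `F^{p+2}`. Hence its lift is
    -- a cocycle and can be subtracted from `ω`.
    obtain ⟨Φ, hΦ, hΦs⟩ := exists_lift (M := M) i π s hs e p
    have hcob := coboundaries_eq_bot i ρ e hρ hN
    have hd : mixed i s m (p + 1) (d ρ (m + p) ω) = 0 := by
      refine (mixed_eq_zero_iff (p := p + 1) i s e hsup).mpr ?_
      rw [← ker_toSubmodule_eq_range i π]
      exact hsFiltration_le_vanishing (by push_cast; linarith) hω.2
    refine ⟨ω - Φ (mixed i s m p ω), (mixed_eq_zero_iff i s e hsup).mp ?_, ?_⟩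
    · rw [map_sub, hΦ, sub_self]
    · rw [map_sub, sub_eq_self]
      refine d_lift i π s ρ hs e hcob (hΦs _) (Submodule.zero_mem _) ?_
      rw [hΦ, ← mixed_d i s _ ρ (incl_kernelRep_comp i π s) hcob, hd, map_zero]
  · push Not at hN
    obtain ⟨x, hx⟩ := hN
    have hm : m ≠ 0 := by
      rintro rfl
      refine hx ?_
      rw [LinearMap.trace_eq_matrix_trace k e]
      simp [Matrix.trace]
    exact exists_mem_vanishing_d_eq i e (lie_incl_mem_range i π) ρ hρ hx (by omega) ω

variable {ρ} in
theorem comp_section_comp_proj (hs : ∀ x, π (s x) = x) (hρ : ∀ y, ρ (i y) = 0) :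
    (ρ.comp s).comp π = ρ := by
  obtain ⟨τ, -, -, h⟩ := exists_retraction i π s hs
  ext x : 1
  conv_rhs => rw [← h x, map_add, hρ, zero_add]
  rfl

/-- Inflation of cochains from `H` to `G`. -/
def inflation (M : Type*) [AddCommGroup M] [Module k M] (n : ℕ) :
    Cochain k H M n →ₗ[k] Cochain k G M n where
  toFun c := c.compLinearMap (π : G →ₗ[k] H)
  map_add' _ _ := rfl
  map_smul' _ _ := rfl

theorem d_inflation (hs : ∀ x, π (s x) = x) (hρ : ∀ y, ρ (i y) = 0) {n : ℕ}
    (c : Cochain k H M n) :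
    d ρ n (inflation π M n c) = inflation π M (n + 1) (d (ρ.comp s) n c) := by
  have h := d_compLinearMap (ρ.comp s) π c
  rwa [comp_section_comp_proj i π s hs hρ] at h

theorem inflation_mem_vanishing {n : ℕ} (c : Cochain k H M n) :
    inflation π M n c ∈ vanishing M (LinearMap.range (i : N →ₗ[k] G)) 1 n := by
  intro v T hT hv
  obtain ⟨j, hj⟩ := Finset.card_pos.mp hT
  obtain ⟨y, hy⟩ := hv j hj
  refine c.map_coord_zero (m := fun l => π (v l)) j ?_
  rw [← hy]
  exact proj_incl i π y

theorem inflation_comp_section (hs : ∀ x, π (s x) = x) {n : ℕ} (c : Cochain k H M n) :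
    (inflation π M n c).compLinearMap (s : H →ₗ[k] G) = c := by
  ext v
  refine congrArg c (funext fun j => hs _)

/-- A cochain that vanishes as soon as one argument lies in `N` is inflated from `H`. -/
theorem inflation_restriction (hs : ∀ x, π (s x) = x) {n : ℕ} {η : Cochain k G M n}
    (h : η ∈ vanishing M (LinearMap.range (i : N →ₗ[k] G)) 1 n) :
    inflation π M n (η.compLinearMap (s : H →ₗ[k] G)) = η := by
  rw [← sub_eq_zero]
  refine eq_zero_of_mem_vanishing (range_sup_range i π s hs) (a := 1) (b := n) (by omega)
    (Submodule.sub_mem _ (inflation_mem_vanishing i π _) h) fun v T hT hv => ?_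
  have hu : T = Finset.univ := by
    refine Finset.eq_univ_of_card T (le_antisymm T.card_le_univ ?_)
    rwa [Fintype.card_fin]
  choose y hy using fun j => hv j (hu ▸ Finset.mem_univ j)
  obtain rfl : (fun j => s (y j)) = v := funext hy
  refine sub_eq_zero.mpr (congrArg η (funext fun j => ?_))
  exact congrArg s (hs (y j))

/-- A differential with values in the bottom row vanishes, because inflation from `H` is split by
restriction along the section. -/
theorem hsDiff_bottom_row (hs : ∀ x, π (s x) = x) (hρ : ∀ y, ρ (i y) = 0) {r : ℕ} (hr : 2 ≤ r)
    {p : ℤ} {n : ℕ} (hn : p + r = n + 1) : hsDiff ρ π.ker r p n = 0 := by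
  refine hsDiff_eq_zero fun ω hω => ⟨inflation π M n (ω.compLinearMap (s : H →ₗ[k] G)), ?_, ?_⟩
  · refine vanishing_le_hsFiltration (b := 1) (by push_cast; linarith) ?_
    rw [ker_toSubmodule_eq_range i π]
    exact inflation_mem_vanishing i π _
  · rw [d_inflation i π s ρ hs hρ, d_compLinearMap]
    refine inflation_restriction i π s hs ?_
    rw [← ker_toSubmodule_eq_range i π]
    exact hsFiltration_le_vanishing (by push_cast; linarith) hω.2

theorem hsDiff_eq_zero_of_max_le (hs : ∀ x, π (s x) = x) (hρ : ∀ y, ρ (i y) = 0) {m : ℕ}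
    (e : Module.Basis (Fin m) k N) {r : ℕ} (hr : 2 ≤ r) (hm : m ≤ r) (p : ℤ) (n : ℕ) :
    hsDiff ρ π.ker r p n = 0 := by
  -- The total degree is `n = p + q`; the rows are indexed by `q = n - p`.
  rcases lt_or_ge p 0 with hp | hp
  · -- For `p < 0`, both `F^p` and `F^{p+1}` are everything.
    refine hsDiff_eq_zero fun ω _ => ⟨ω, ?_, rfl⟩
    exact vanishing_le_hsFiltration (b := n + 1) (by push_cast; linarith)
      (mem_vanishing_of_lt (Nat.lt_succ_self n) ω)
  lift p to ℕ using hp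
  rcases lt_trichotomy n (m + p) with h | rfl | h
  · rcases eq_or_ne (p + r) (n + 1) with h1 | h1
    · exact hsDiff_bottom_row i π s ρ hs hρ hr (by exact_mod_cast h1)
    · -- The target has `q - r + 1 < 0`, where the filtration is zero.
      refine hsDiff_eq_zero fun ω hω => ⟨0, Submodule.zero_mem _, ?_⟩
      rw [map_zero]
      refine (eq_zero_of_mem_vanishing_zero
        (hsFiltration_le_vanishing (b := 0) ?_ hω.2)).symm
      push_cast
      omega
  · exact hsDiff_top_row i π s ρ hs hρ e hr p
  · -- For `q > m` there is no difference between `F^p` and `F^{p+1}`.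
    refine hsDiff_eq_zero fun ω _ => ⟨ω, ?_, rfl⟩
    refine vanishing_le_hsFiltration (b := m + 1) (by push_cast; omega) ?_
    rw [ker_toSubmodule_eq_range i π]
    exact mem_vanishing_range_succ i e ω

/-- If `N` is not unimodular, its cohomology in top degree with trivial coefficients is zero. -/
theorem subsingleton_cohomology_top {m : ℕ} (e : Module.Basis (Fin m) k N)
    (ρ : N →ₗ⁅k⁆ Module.End k M) (hρ : ∀ y, ρ y = 0) {x : N}
    (hx : LinearMap.trace k N (LieAlgebra.ad k N x) ≠ 0) (hm : m ≠ 0) :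
    Subsingleton (Cohomology ρ m) := by
  obtain ⟨m, rfl⟩ := Nat.exists_eq_succ_of_ne_zero hm
  have : FiniteDimensional k N := e.finiteDimensional_of_finite
  refine Submodule.Quotient.subsingleton_iff.mpr (eq_top_iff.mpr ?_)
  rintro ⟨ω, hω⟩ -
  have h := contract_d ρ ω x
  rw [hρ, lieDer_top e, (show d ρ (m + 1) ω = 0 from hω)] at h
  set t := LinearMap.trace k N (LieAlgebra.ad k N x)
  refine ⟨-(t⁻¹ • contract x ω), ?_⟩
  have h' : d ρ m (contract x ω) = -(t • ω) := by
    rw [eq_comm, ← sub_eq_zero, ← h]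
    simp [contract]
  rw [map_neg, map_smul, h', smul_neg, neg_neg, smul_smul, inv_mul_cancel₀ hx, one_smul]
  rfl

theorem restriction_mem_coboundaries {n : ℕ} {ω : Cochain k G M n} (h : ω ∈ coboundaries ρ n) :
    ω.compLinearMap (s : H →ₗ[k] G) ∈ coboundaries (ρ.comp s) n := by
  cases n with
  | zero =>
    obtain rfl : ω = 0 := h
    exact Submodule.zero_mem _
  | succ n =>
    obtain ⟨η, rfl⟩ := h
    exact ⟨_, d_compLinearMap ρ s η⟩

theorem inflation_mem_coboundaries (hs : ∀ x, π (s x) = x) (hρ : ∀ y, ρ (i y) = 0) {n : ℕ}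
    {c : Cochain k H M n} (h : c ∈ coboundaries (ρ.comp s) n) :
    inflation π M n c ∈ coboundaries ρ n := by
  cases n with
  | zero =>
    obtain rfl : c = 0 := h
    exact Submodule.zero_mem _
  | succ n =>
    obtain ⟨η, rfl⟩ := h
    exact ⟨_, d_inflation i π s ρ hs hρ η⟩

/-- If the differential into the top degree `m = dim N` vanishes, then `H^m(N, M)` is `C^m(N, M)`,
compatibly with the actions of `H`. -/
theorem exists_equiv_cohomology_top {m : ℕ} (e : Module.Basis (Fin m) k N)
    (hcob : coboundaries (ρ.comp i) m = ⊥) :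
    ∃ ψ : Cochain k N M m ≃ₗ[k] Cohomology (ρ.comp i) m, ∀ x η,
      ψ (cochainRep ((kernelRep i π).comp s) (ρ.comp s) m x η) =
        (kernelCohomologyRep i π ρ m).comp s x (ψ η) := by
  have : FiniteDimensional k N := e.finiteDimensional_of_finite
  have hcoc : ∀ η : Cochain k N M m, η ∈ cocycles (ρ.comp i) m := fun η =>
    eq_zero_of_finrank_lt (by rw [Module.finrank_eq_card_basis e, Fintype.card_fin]; omega) _
  let ψ : Cochain k N M m →ₗ[k] Cohomology (ρ.comp i) m :=
    Submodule.mkQ _ ∘ₗ LinearMap.codRestrict (cocycles (ρ.comp i) m) LinearMap.id hcoc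
  have hψ : Function.Bijective ψ := by
    constructor
    · rw [← LinearMap.ker_eq_bot, LinearMap.ker_eq_bot']
      intro η hη
      have h : η ∈ coboundaries (ρ.comp i) m := (cohomology_mk_eq_zero_iff ⟨η, hcoc η⟩).mp hη
      rwa [hcob] at h
    · intro z
      obtain ⟨⟨η, hη⟩, rfl⟩ := Submodule.Quotient.mk_surjective _ z
      exact ⟨η, rfl⟩
  exact ⟨LinearEquiv.ofBijective ψ hψ, fun x η => rfl⟩

/-- If the differential into the top row vanishes, lifting that row to `G` induces an embedding of
`H^p(H, H^m(N, M))`, `m = dim N`, in `H^{m+p}(G, M)`. If `m ≠ 0`, the lifts restrict to zero on `H`,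
hence this embedding and inflation together are still injective. -/
theorem exists_injective_of_coboundaries_eq_bot (hs : ∀ x, π (s x) = x) (hρ : ∀ y, ρ (i y) = 0)
    {m : ℕ} (e : Module.Basis (Fin m) k N) (hm : m ≠ 0)
    (hcob : coboundaries (ρ.comp i) m = ⊥) (p : ℕ) :
    ∃ f : (Cohomology ((kernelCohomologyRep i π ρ m).comp s) p ×
      Cohomology (ρ.comp s) (m + p)) →ₗ[k] Cohomology ρ (m + p), Function.Injective f := by
  set σ := (kernelCohomologyRep i π ρ m).comp s
  set σ' := cochainRep ((kernelRep i π).comp s) (ρ.comp s) m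
  obtain ⟨ψ, hψ⟩ := exists_equiv_cohomology_top i π s ρ e hcob
  choose Φ hΦ hΦs using fun p => exists_lift (M := M) i π s hs e p
  have hψ' : ∀ x v, ψ.symm (σ x v) = σ' x (ψ.symm v) := fun x v => by
    rw [LinearEquiv.symm_apply_eq, hψ, LinearEquiv.apply_symm_apply]
  -- Identify `H^m(N, M)` with `C^m(N, M)` and lift to `G`.
  let A : ∀ p, Cochain k H (Cohomology (ρ.comp i) m) p →ₗ[k] Cochain k G M (m + p) := fun p =>
    Φ p ∘ₗ
      { toFun := fun c => ψ.symm.toLinearMap.compAlternatingMap c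
        map_add' := fun _ _ => by ext; simp
        map_smul' := fun _ _ => by ext; simp }
  have hmA : ∀ {p} c, mixed i s m p (A p c) = ψ.symm.toLinearMap.compAlternatingMap c :=
    fun c => hΦ _ _
  have hdA : ∀ {p} c, d ρ (m + p) (A p c) = A (p + 1) (d σ p c) := fun {p} c =>
    d_lift i π s ρ hs e hcob (hΦs _ _) (hΦs _ _) <| by
      rw [hmA, hmA]
      exact (d_compAlternatingMap σ σ' ψ.symm.toLinearMap hψ' c).symm
  have hrA : ∀ {p} c, (A p c).compLinearMap (s : H →ₗ[k] G) = 0 := fun {p} c => by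
    ext v
    exact hΦs p _ _ Finset.univ (by rw [Finset.card_univ, Fintype.card_fin]; omega)
      fun j _ => ⟨v j, rfl⟩
  have hbA : ∀ c ∈ coboundaries σ p, A p c ∈ coboundaries ρ (m + p) := by
    cases p with
    | zero =>
      intro c hc
      obtain rfl : c = 0 := hc
      rw [map_zero]
      exact Submodule.zero_mem _
    | succ p =>
      rintro _ ⟨c, rfl⟩
      exact ⟨A p c, hdA c⟩
  -- The component of a primitive of `A p c` is a primitive of `c`.
  have hAb : ∀ c, A p c ∈ coboundaries ρ (m + p) → c ∈ coboundaries σ p := by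
    intro c hc
    have hcψ : ψ.toLinearMap.compAlternatingMap (mixed i s m p (A p c)) = c := by
      rw [hmA]; ext; simp
    cases p with
    | zero =>
      obtain ⟨m, rfl⟩ := Nat.exists_eq_succ_of_ne_zero hm
      obtain ⟨β, hβ⟩ : ∃ β, d ρ m β = A 0 c := hc
      change c = 0
      rw [← hcψ]
      have h0 : mixed i s (m + 1) 0 (A 0 c) = 0 := by
        refine AlternatingMap.ext fun v => ?_
        rw [mixed_zero_apply, ← hβ]
        have h : (d ρ m β).compLinearMap (i : N →ₗ[k] G) ∈ coboundaries (ρ.comp i) (m + 1) :=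
          ⟨_, d_compLinearMap ρ i β⟩
        rw [hcob] at h
        exact h
      rw [h0]
      ext; simp
    | succ p =>
      obtain ⟨β, hβ⟩ : ∃ β, d ρ (m + p) β = A (p + 1) c := hc
      refine ⟨ψ.toLinearMap.compAlternatingMap (mixed i s m p β), ?_⟩
      rw [d_compAlternatingMap σ' σ ψ.toLinearMap hψ, ← hcψ, ← hβ]
      exact congrArg _ (mixed_d i s _ ρ (incl_kernelRep_comp i π s) hcob β).symm
  have hcA : ∀ c, d σ p c = 0 → d ρ (m + p) (A p c) = 0 := fun c hc => by
    rw [hdA, hc, map_zero]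
  have hcI : ∀ c, d (ρ.comp s) (m + p) c = 0 → d ρ (m + p) (inflation π M (m + p) c) = 0 :=
    fun c hc => by rw [d_inflation i π s ρ hs hρ, hc, map_zero]
  refine ⟨LinearMap.coprod (cohomologyMap σ ρ (A p) hcA hbA)
    (cohomologyMap (ρ.comp s) ρ (inflation π M (m + p)) hcI
      (fun c hc => inflation_mem_coboundaries i π s ρ hs hρ hc)), ?_⟩
  rw [← LinearMap.ker_eq_bot, LinearMap.ker_eq_bot']
  rintro ⟨a, b⟩ hab
  obtain ⟨⟨a, ha⟩, rfl⟩ := Submodule.Quotient.mk_surjective _ a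
  obtain ⟨⟨b, hb⟩, rfl⟩ := Submodule.Quotient.mk_surjective _ b
  have h : A p a + inflation π M (m + p) b ∈ coboundaries ρ (m + p) :=
    (cohomology_mk_eq_zero_iff ⟨A p a + inflation π M (m + p) b,
      Submodule.add_mem _ (hcA a ha) (hcI b hb)⟩).mp hab
  -- Restriction to `H` kills the lift of `a` and inverts the inflation of `b`.
  have hb' : b ∈ coboundaries (ρ.comp s) (m + p) := by
    have := restriction_mem_coboundaries s ρ h
    rwa [show (A p a + inflation π M (m + p) b).compLinearMap (s : H →ₗ[k] G) =
      (A p a).compLinearMap (s : H →ₗ[k] G) +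
        (inflation π M (m + p) b).compLinearMap (s : H →ₗ[k] G) from rfl, hrA, zero_add,
      inflation_comp_section π s hs] at this
  have ha' : a ∈ coboundaries σ p :=
    hAb a ((Submodule.add_mem_iff_left _ (inflation_mem_coboundaries i π s ρ hs hρ hb')).mp h)
  exact Prod.ext ((Submodule.Quotient.mk_eq_zero _).mpr ha')
    ((Submodule.Quotient.mk_eq_zero _).mpr hb')

theorem exists_injective (hs : ∀ x, π (s x) = x) (hρ : ∀ y, ρ (i y) = 0) {m : ℕ}
    (e : Module.Basis (Fin m) k N) (hm : m ≠ 0) (p : ℕ) :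
    ∃ f : (Cohomology ((kernelCohomologyRep i π ρ m).comp s) p ×
      Cohomology (ρ.comp s) (m + p)) →ₗ[k] Cohomology ρ (m + p), Function.Injective f := by
  by_cases hN : ∀ y, LinearMap.trace k N (LieAlgebra.ad k N y) = 0
  · exact exists_injective_of_coboundaries_eq_bot i π s ρ hs hρ e hm
      (coboundaries_eq_bot i ρ e hρ hN) p
  · push Not at hN
    obtain ⟨x, hx⟩ := hN
    have := subsingleton_cohomology_top e (ρ.comp i) hρ hx hm
    have hcI : ∀ c, d (ρ.comp s) (m + p) c = 0 → d ρ (m + p) (inflation π M (m + p) c) = 0 :=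
      fun c hc => by rw [d_inflation i π s ρ hs hρ, hc, map_zero]
    refine ⟨cohomologyMap (ρ.comp s) ρ (inflation π M (m + p)) hcI
      (fun c hc => inflation_mem_coboundaries i π s ρ hs hρ hc) ∘ₗ LinearMap.snd k _ _, ?_⟩
    rw [← LinearMap.ker_eq_bot, LinearMap.ker_eq_bot']
    rintro ⟨a, b⟩ hab
    obtain ⟨⟨a, ha⟩, rfl⟩ := Submodule.Quotient.mk_surjective _ a
    obtain ⟨⟨b, hb⟩, rfl⟩ := Submodule.Quotient.mk_surjective _ b
    have h : inflation π M (m + p) b ∈ coboundaries ρ (m + p) :=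
      (cohomology_mk_eq_zero_iff ⟨_, hcI b hb⟩).mp hab
    have hb' := restriction_mem_coboundaries s ρ h
    rw [inflation_comp_section π s hs] at hb'
    refine Prod.ext ?_ ((Submodule.Quotient.mk_eq_zero _).mpr hb')
    obtain rfl : a = 0 := AlternatingMap.ext fun v => Subsingleton.elim _ _
    exact (Submodule.Quotient.mk_eq_zero _).mpr (Submodule.zero_mem _)

end Extension

end LieCohomology

theorem mainTheorem3 {k 𝔫 𝔤 𝔥 M : Type*} [Field k]
    [LieRing 𝔫] [LieAlgebra k 𝔫] [LieRing 𝔤] [LieAlgebra k 𝔤] [LieRing 𝔥] [LieAlgebra k 𝔥]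
    (i : 𝔫 →ₗ⁅k⁆ 𝔤) (π : 𝔤 →ₗ⁅k⁆ 𝔥) [LieAlgebra.IsExtension i π]
    (s : 𝔥 →ₗ⁅k⁆ 𝔤) (hs : ∀ x, π (s x) = x)
    [FiniteDimensional k 𝔫] (m : ℕ) (hm : Module.finrank k 𝔫 = m)
    [AddCommGroup M] [Module k M] [LieRingModule 𝔤 M] [LieModule k 𝔤 M]
    (htriv : ∀ (x : 𝔫) (y : M), ⁅i x, y⁆ = 0) :
    (∀ r : ℕ, 2 ≤ r → ∀ p : ℕ,
      LieCohomology.hsDiff (LieModule.toEnd k 𝔤 M) π.ker r p (p + m) = 0) ∧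
    LieCohomology.hsLength (LieModule.toEnd k 𝔤 M) π.ker ≤ max 2 (m : ℕ∞) ∧
    (1 ≤ m → ∀ p : ℕ, ∃ f :
      (LieCohomology.Cohomology
          ((LieCohomology.kernelCohomologyRep i π (LieModule.toEnd k 𝔤 M) m).comp s) p ×
        LieCohomology.Cohomology ((LieModule.toEnd k 𝔤 M).comp s) (p + m)) →ₗ[k]
      LieCohomology.Cohomology (LieModule.toEnd k 𝔤 M) (p + m), Function.Injective f) := by
  have hρ : ∀ y, LieModule.toEnd k 𝔤 M (i y) = 0 := fun y => LinearMap.ext (htriv y)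
  let e : Module.Basis (Fin m) k 𝔫 := Module.finBasisOfFinrankEq k 𝔫 hm
  refine ⟨fun r hr p => ?_, ?_, fun h p => ?_⟩
  · rw [Nat.add_comm]
    exact LieCohomology.hsDiff_top_row i π s _ hs hρ e hr p
  · refine (iInf₂_le (max 2 m) ⟨le_max_left _ _, fun r hr => ?_⟩).trans le_rfl
    exact LieCohomology.hsDiff_eq_zero_of_max_le i π s _ hs hρ e (le_of_max_le_left hr)
      (le_of_max_le_right hr)
  · rw [Nat.add_comm]
    exact LieCohomology.exists_injective i π s _ hs hρ e (Nat.one_le_iff_ne_zero.mp h) p
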